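/- Let $\tau\in\mathbb C$ with $\operatorname{Im}\tau>0$, $\Lambda=\mathbb Z+\mathbb Z\tau$, $E=\mathbb C/\Lambda$, $X=E\setminus\{0\}$, and for $n\ge 0$ let $\Gamma_n$ be the coordinate ring of $F(X,n)=\{(x_1,\dots,x_n)\in X^n: x_i\ne x_j \text{ for } i\neq j\}$, with derivations $\partial_i=\partial/\partial x_i$. For $q\in\mathbb Z$ let $G_q\Gamma_n\subset\Gamma_n$ be the subspace of functions which, locally on $E^n$, are sums of products of at most $q+n$ functions each having poles along a single one of the divisors $\{x_i=0\}$, $\{x_i=x_j\}$ (that is, sums of functions whose poles lie on at most $q+n$ of these divisors; $G_q\Gamma_n=0$ if $q<-n$). Let $V=\bigoplus_{\Delta\ge 0}V_\Delta$ be a graded vertex algebra over $\mathbb C$ with products $a_{(m)}b$, vacuum $\mathbf 1$, fields $Y(a,z)=\sum_{m}a_{(m)}z^{-m-1}$ and translation operator $Ta=a_{(-2)}\mathbf 1$, and let $(G_pV)_{p\in\mathbb Z}$ be a good increasing filtration of $V$: an increasing exhaustive filtration by subspaces such that for $a\in G_pV$, $b\in G_qV$ one has $a_{(m)}b\in G_{p+q}V$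 for all $m\in\mathbb Z$ and $a_{(m)}b\in G_{p+q-1}V$ for all $m\ge 0$. Put $$G_pV^{\otimes n+1}=\sum_{p_1+\cdots+p_{n+1}\le p}G_{p_1}V\otimes\cdots\otimes G_{p_{n+1}}V .$$ Let $\widetilde C_n=\Gamma_n\otimes V^{\otimes n+1}$ and $C_n=\widetilde C_n/\sum_{i=1}^n(\partial_i+T_i)\widetilde C_n$, where $T_i$ is $T$ acting on the $i$-th tensor factor. Let $d:\widetilde C_n\to\widetilde C_{n-1}$ ($n\ge 1$) be $$d=\sum_{1\le i<j\le n}(-1)^{n-i}d^{(ij)}+\sum_{1\le i\le n}(-1)^{n-i}p^{(i)},$$ where $d^{(ij)}$ sends $f\otimes a^1\otimes\cdots\otimes a^n\otimes b$ to $\operatorname{Res}_{x_i=x_j}f\otimes a^1\otimes\cdots\widehat{a^i}\cdots\otimes Y(a^i,x_i-x_j)a^j\otimes\cdots\otimes a^n\otimes b$, and $p^{(i)}$ sends it to $\operatorname{Res}_{x_i=0}f\otimes a^1\otimes\cdots\widehat{a^i}\cdots\otimes a^n\otimes Y(a^i,x_i)b$, the remaining variables being renamed $x_1,\dots,x_{n-1}$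 in order. Let the Hodge filtration $G_pC_n$ be the image in $C_n$ of $$\sum_{p'+p''\le p}G_{p'}\Gamma_n\otimes G_{p''}V^{\otimes n+1}.$$ Then $d$ induces linear maps $d:C_n\to C_{n-1}$, and for all $n$ and all $p\le p'$ one has $G_pC_n\subset G_{p'}C_n$ and $d(G_pC_n)\subset G_pC_{n-1}$ (the latter for $n\ge 1$). That is, $G$ is an increasing filtration of the ordered chiral complex $(C_\bullet,d)$, stable under the differential. -/

import Mathlib

open Filter Topology

namespace ChiralHodge

noncomputable section

/-- The pair of periods `(1, τ)`; its lattice is `Λ = ℤ + ℤ τ`. -/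
def periods (τ : UpperHalfPlane) : PeriodPair where
  ω₁ := 1
  ω₂ := (τ : ℂ)
  indep := by
    rw [LinearIndependent.pair_iff]
    intro s t h
    have him := congrArg Complex.im h
    have hre := congrArg Complex.re h
    have hτ : (τ : ℂ).im ≠ 0 := τ.im_pos.ne'
    simp at him
    have ht : t = 0 := by
      rcases him with h | h
      · exact h
      · exact absurd h hτ
    subst ht
    simp at hre
    exact ⟨hre, rfl⟩

/-- A point `x = (x_1, …, x_n)` completed to `(x_1, …, x_n, x_{n+1})` with `x_{n+1} = 0`. -/
def pts {n : ℕ} (x : Fin n → ℂ) : Fin (n + 1) → ℂ := Fin.snoc (α := fun _ => ℂ) x 0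

/-- The preimage in `ℂ^n` of the configuration space `F(X, n)`, `X = ℂ/Λ ∖ {0}`: since
`x_{n+1} = 0`, the conditions are `x_i ∉ Λ` and `x_i - x_j ∉ Λ` for `i ≠ j`. -/
def conf (L : PeriodPair) (n : ℕ) : Set (Fin n → ℂ) :=
  {x | ∀ i j : Fin (n + 1), i ≠ j → pts x i - pts x j ∉ L.lattice}

/-- The linear form `x_i - x_j`, where `p = (i, j)` and `x_{n+1} = 0`. -/
def lin {n : ℕ} (p : Fin (n + 1) × Fin (n + 1)) (x : Fin n → ℂ) : ℂ := pts x p.1 - pts x p.2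

open Classical in
/-- The divisors `{x_i = x_j}`, `i < j ≤ n + 1` (those with `j = n + 1` are `{x_i = 0}`) of `E^n`
which pass through the image of `P ∈ ℂ^n`. -/
def divAt (L : PeriodPair) {n : ℕ} (P : Fin n → ℂ) : Finset (Fin (n + 1) × Fin (n + 1)) :=
  Finset.univ.filter fun p => p.1 < p.2 ∧ lin p P ∈ L.lattice

/-- The product of the local equations at `P` of the divisors in `S`. -/
def eqn {n : ℕ} (S : Finset (Fin (n + 1) × Fin (n + 1))) (P x : Fin n → ℂ) : ℂ :=
  ∏ p ∈ S, lin p (x - P)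

/-- Near `P` the function `f` is meromorphic with poles of order at most `N` along each of the
divisors through `P`. -/
def PoleAt (L : PeriodPair) {n : ℕ} (N : ℕ) (P : Fin n → ℂ) (f : (Fin n → ℂ) → ℂ) : Prop :=
  ∃ g : (Fin n → ℂ) → ℂ, AnalyticAt ℂ g P ∧
    ∀ᶠ x in 𝓝 P, x ∈ conf L n → f x = g x / eqn (divAt L P) P x ^ N

@[simp] lemma pts_last {n : ℕ} (x : Fin n → ℂ) : pts x (Fin.last n) = 0 := by simp [pts]
@[simp] lemma pts_castSucc {n : ℕ} (x : Fin n → ℂ) (i : Fin n) : pts x i.castSucc = x i := by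
  simp [pts]

lemma mem_conf_iff (L : PeriodPair) (n : ℕ) (x : Fin n → ℂ) :
    x ∈ conf L n ↔ (∀ i, x i ∉ L.lattice) ∧ ∀ i j, i ≠ j → x i - x j ∉ L.lattice := by
  constructor
  · intro h
    refine ⟨fun i => ?_, fun i j hij => ?_⟩
    · simpa using h i.castSucc (Fin.last n) (Fin.castSucc_lt_last i).ne
    · simpa using h i.castSucc j.castSucc (by simpa using hij)
  · rintro ⟨h1, h2⟩ i j hij
    induction i using Fin.lastCases with
    | last =>
      induction j using Fin.lastCases with
      | last => exact absurd rfl hij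
      | cast j =>
        intro h
        apply h1 j
        simpa using h
    | cast i =>
      induction j using Fin.lastCases with
      | last => simpa using h1 i
      | cast j => simpa using h2 i j (by simpa using hij)

lemma pts_add {n : ℕ} (x y : Fin n → ℂ) (i : Fin (n + 1)) : pts (x + y) i = pts x i + pts y i := by
  induction i using Fin.lastCases <;> simp

lemma pts_sub {n : ℕ} (x y : Fin n → ℂ) (i : Fin (n + 1)) : pts (x - y) i = pts x i - pts y i := by
  induction i using Fin.lastCases <;> simp

lemma lin_sub {n : ℕ} (p) (x y : Fin n → ℂ) : lin p (x - y) = lin p x - lin p y := by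
  simp only [lin, pts_sub]; ring

lemma analyticAt_pts {n : ℕ} (i : Fin (n + 1)) (P : Fin n → ℂ) :
    AnalyticAt ℂ (fun x => pts x i) P := by
  induction i using Fin.lastCases with
  | last => simpa using analyticAt_const
  | cast i =>
    simp only [pts_castSucc]
    exact (ContinuousLinearMap.proj (R := ℂ) (φ := fun _ : Fin n => ℂ) i).analyticAt P

lemma analyticAt_lin {n : ℕ} (p) (P Q : Fin n → ℂ) :
    AnalyticAt ℂ (fun x => lin p (x - Q)) P := by
  simp only [lin_sub]
  exact (((analyticAt_pts _ P).sub (analyticAt_pts _ P))).sub analyticAt_const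

lemma analyticAt_eqn {n : ℕ} (S) (P Q : Fin n → ℂ) :
    AnalyticAt ℂ (fun x => eqn S Q x) P :=
  Finset.analyticAt_fun_prod _ fun p _ => analyticAt_lin p P Q

lemma continuous_pts {n : ℕ} (i : Fin (n + 1)) : Continuous (fun x : Fin n → ℂ => pts x i) :=
  continuous_iff_continuousAt.2 fun x => (analyticAt_pts i x).continuousAt

lemma isOpen_conf (L : PeriodPair) (n : ℕ) : IsOpen (conf L n) := by
  have : conf L n = ⋂ i, ⋂ j, ⋂ (_ : i ≠ j),
      (fun x : Fin n → ℂ => pts x i - pts x j) ⁻¹' ((L.lattice : Set ℂ)ᶜ) := by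
    ext x; simp [conf]
  rw [this]
  refine isOpen_iInter_of_finite fun i => isOpen_iInter_of_finite fun j =>
    isOpen_iInter_of_finite fun _ => ?_
  exact L.isClosed_lattice.isOpen_compl.preimage ((continuous_pts i).sub (continuous_pts j))

lemma lin_ne_zero {L : PeriodPair} {n : ℕ} {P x : Fin n → ℂ} (hx : x ∈ conf L n) {p}
    (hp : p ∈ divAt L P) : lin p (x - P) ≠ 0 := by
  simp only [divAt, Finset.mem_filter, Finset.mem_univ, true_and] at hp
  intro h
  rw [lin_sub, sub_eq_zero] at h
  exact hx p.1 p.2 hp.1.ne (by rw [← lin, h]; exact hp.2)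

lemma eqn_ne_zero {L : PeriodPair} {n : ℕ} {P x : Fin n → ℂ} (hx : x ∈ conf L n) {S}
    (hS : S ⊆ divAt L P) : eqn S P x ≠ 0 :=
  Finset.prod_ne_zero_iff.2 fun _ hp => lin_ne_zero hx (hS hp)

lemma PoleAt.mono {L : PeriodPair} {n N M : ℕ} {P : Fin n → ℂ} {f} (h : PoleAt L N P f)
    (hNM : N ≤ M) : PoleAt L M P f := by
  obtain ⟨g, hg, h⟩ := h
  refine ⟨fun x => g x * eqn (divAt L P) P x ^ (M - N), hg.mul ((analyticAt_eqn _ _ _).pow _), ?_⟩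
  filter_upwards [h] with x hx hxc
  have := eqn_ne_zero hxc (le_refl (divAt L P))
  rw [hx hxc, div_eq_div_iff (pow_ne_zero _ this) (pow_ne_zero _ this), mul_assoc, ← pow_add,
    Nat.sub_add_cancel hNM]

lemma PoleAt.add {L : PeriodPair} {n N : ℕ} {P : Fin n → ℂ} {f f'} (h : PoleAt L N P f)
    (h' : PoleAt L N P f') : PoleAt L N P (f + f') := by
  obtain ⟨g, hg, h⟩ := h
  obtain ⟨g', hg', h'⟩ := h'
  refine ⟨g + g', hg.add hg', ?_⟩
  filter_upwards [h, h'] with x hx hx' hxc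
  simp [hx hxc, hx' hxc, add_div]

lemma PoleAt.mul {L : PeriodPair} {n N M : ℕ} {P : Fin n → ℂ} {f f'} (h : PoleAt L N P f)
    (h' : PoleAt L M P f') : PoleAt L (N + M) P (f * f') := by
  obtain ⟨g, hg, h⟩ := h
  obtain ⟨g', hg', h'⟩ := h'
  refine ⟨g * g', hg.mul hg', ?_⟩
  filter_upwards [h, h'] with x hx hx' hxc
  simp [hx hxc, hx' hxc, pow_add, div_mul_div_comm]

lemma PoleAt.pow {L : PeriodPair} {n N : ℕ} {P : Fin n → ℂ} {f} (h : PoleAt L N P f) (k : ℕ) :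
    PoleAt L (N * k) P (f ^ k) := by
  obtain ⟨g, hg, h⟩ := h
  refine ⟨g ^ k, hg.pow k, ?_⟩
  filter_upwards [h] with x hx hxc
  simp [hx hxc, div_pow, pow_mul]

lemma AnalyticAt.poleAt {L : PeriodPair} {n : ℕ} {P : Fin n → ℂ} {f} (h : AnalyticAt ℂ f P) :
    PoleAt L 0 P f := ⟨f, h, by simp⟩

lemma PoleAt.prod {L : PeriodPair} {n : ℕ} {P : Fin n → ℂ} {ι : Type*} (s : Finset ι) (N : ℕ)
    (f : ι → (Fin n → ℂ) → ℂ) (h : ∀ i ∈ s, PoleAt L N P (f i)) :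
    PoleAt L (s.card * N) P (∏ i ∈ s, f i) := by
  classical
  induction s using Finset.induction_on with
  | empty => simpa using (AnalyticAt.poleAt (L := L) (P := P) (f := 1) analyticAt_const)
  | insert a s ha ih =>
    rw [Finset.prod_insert ha, Finset.card_insert_of_notMem ha, add_mul, one_mul, add_comm]
    exact (h a (by simp)).mul (ih fun i hi => h i (by simp [hi]))

lemma PoleAt.inv_lin {L : PeriodPair} {n : ℕ} {P : Fin n → ℂ} {p} (hp : p ∈ divAt L P) :
    PoleAt L 1 P (fun x => (lin p (x - P))⁻¹) := by
  classical
  refine ⟨fun x => eqn ((divAt L P).erase p) P x, analyticAt_eqn _ _ _, ?_⟩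
  refine Eventually.of_forall fun x hx => ?_
  have h1 := lin_ne_zero hx hp
  have h2 := eqn_ne_zero hx ((divAt L P).erase_subset p)
  have h3 : eqn (divAt L P) P x = lin p (x - P) * eqn ((divAt L P).erase p) P x :=
    (Finset.mul_prod_erase _ _ hp).symm
  rw [pow_one, h3]
  field_simp

lemma PoleAt.congr {L : PeriodPair} {n N : ℕ} {P : Fin n → ℂ} {f f'} (h : PoleAt L N P f)
    (h' : ∀ᶠ x in 𝓝 P, x ∈ conf L n → f' x = f x) : PoleAt L N P f' := by
  obtain ⟨g, hg, h⟩ := h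
  refine ⟨g, hg, ?_⟩
  filter_upwards [h, h'] with x hx hx' hxc
  rw [hx' hxc, hx hxc]

/-- The coordinate ring `Γ_n` of `F(X, n)` as a space of functions on `ℂ^n`: the `Λ^n`-periodic
functions that are holomorphic on the preimage of `F(X, n)` and have poles of bounded order along
the complementary divisors of `E^n` (at a point `P` of `conf L n` no divisor passes through `P`,
and `PoleAt` means analyticity). Outside `conf L n` they are given the value `0`. Meromorphic
functions on the projective variety `E^n` being rational, these are the regular functions. -/
def regFun (L : PeriodPair) (n : ℕ) : Submodule ℂ ((Fin n → ℂ) → ℂ) where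
  carrier := {f | (∀ x, x ∉ conf L n → f x = 0) ∧
    (∀ x v : Fin n → ℂ, (∀ i, v i ∈ L.lattice) → f (x + v) = f x) ∧
    ∃ N : ℕ, ∀ P, PoleAt L N P f}
  zero_mem' := ⟨fun _ _ => rfl, fun _ _ _ => rfl, 0, fun _ => ⟨0, analyticAt_const, by simp⟩⟩
  add_mem' := by
    rintro f g ⟨h1, h2, N, h3⟩ ⟨k1, k2, M, k3⟩
    refine ⟨fun x hx => by simp [h1 x hx, k1 x hx], fun x v hv => by simp [h2 x v hv, k2 x v hv],
      max N M, fun P => ((h3 P).mono (le_max_left _ _)).add ((k3 P).mono (le_max_right _ _))⟩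
  smul_mem' := by
    rintro c f ⟨h1, h2, N, h3⟩
    refine ⟨fun x hx => by simp [h1 x hx], fun x v hv => by simp [h2 x v hv], N, fun P => ?_⟩
    have := (AnalyticAt.poleAt (L := L) (f := fun _ => c) (P := P) analyticAt_const).mul (h3 P)
    rw [zero_add] at this
    exact this

/-- The coordinate ring `Γ_n` as a complex vector space. -/
def Gam (L : PeriodPair) (n : ℕ) : Type := regFun L n

instance (L : PeriodPair) (n : ℕ) : AddCommGroup (Gam L n) :=
  inferInstanceAs (AddCommGroup (regFun L n))

instance (L : PeriodPair) (n : ℕ) : Module ℂ (Gam L n) :=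
  inferInstanceAs (Module ℂ (regFun L n))

lemma divAt_of_mem {L : PeriodPair} {n : ℕ} {P : Fin n → ℂ} (hP : P ∈ conf L n) :
    divAt L P = ∅ := by
  classical
  simp only [divAt, Finset.filter_eq_empty_iff, Finset.mem_univ, true_implies, not_and]
  intro p hp
  exact hP p.1 p.2 hp.ne

lemma PoleAt.analyticAt {L : PeriodPair} {n N : ℕ} {P : Fin n → ℂ} {f} (h : PoleAt L N P f)
    (hP : P ∈ conf L n) : AnalyticAt ℂ f P := by
  obtain ⟨g, hg, h⟩ := h
  refine hg.congr ?_
  filter_upwards [h, (isOpen_conf L n).mem_nhds hP] with x hx hxc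
  rw [hx hxc, divAt_of_mem hP]
  simp [eqn]

open Classical in
/-- The partial derivative of a function on `F(X, n)`. -/
def partialFun (L : PeriodPair) {n : ℕ} (i : Fin n) (f : (Fin n → ℂ) → ℂ) (x : Fin n → ℂ) : ℂ :=
  if x ∈ conf L n then fderiv ℂ f x (Pi.single i 1) else 0

lemma add_mem_conf {L : PeriodPair} {n : ℕ} {x v : Fin n → ℂ} (hv : ∀ i, v i ∈ L.lattice) :
    x + v ∈ conf L n ↔ x ∈ conf L n := by
  have hv' : ∀ i, pts v i ∈ L.lattice := by
    intro i
    induction i using Fin.lastCases <;> simp [hv]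
  simp only [conf, Set.mem_ofPred_eq]
  refine forall_congr' fun i => forall_congr' fun j => imp_congr_right fun _ => not_congr ?_
  have : pts (x + v) i - pts (x + v) j = (pts x i - pts x j) + (pts v i - pts v j) := by
    simp only [pts_add]; ring
  rw [this]
  exact Submodule.add_mem_iff_left _ (sub_mem (hv' i) (hv' j))

lemma partialFun_mem {L : PeriodPair} {n : ℕ} (i : Fin n) {f} (hf : f ∈ regFun L n) :
    partialFun L i f ∈ regFun L n := by
  obtain ⟨h1, h2, N, h3⟩ := hf
  refine ⟨fun x hx => if_neg hx, fun x v hv => ?_, N + 1, fun P => ?_⟩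
  · have : (fun y => f (y + v)) = f := funext fun y => h2 y v hv
    simp only [partialFun]
    rw [← fderiv_comp_add_right, this]
    classical
    exact if_congr (add_mem_conf hv) rfl rfl
  · obtain ⟨g, hg, h⟩ := h3 P
    set Q := fun x => eqn (divAt L P) P x with hQ
    have hQa : ∀ x, AnalyticAt ℂ Q x := fun x => analyticAt_eqn _ _ _
    let e : Fin n → ℂ := Pi.single i 1
    have hda : ∀ k : (Fin n → ℂ) → ℂ, AnalyticAt ℂ k P →
        AnalyticAt ℂ (fun x => fderiv ℂ k x e) P := fun k hk =>
      ((ContinuousLinearMap.apply ℂ ℂ e).analyticAt _).comp hk.fderiv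
    refine ⟨fun x => fderiv ℂ g x e * Q x - N * g x * fderiv ℂ Q x e, ?_, ?_⟩
    · exact ((hda g hg).mul (hQa P)).sub
        ((analyticAt_const.mul hg).mul (hda Q (hQa P)))
    · filter_upwards [h.eventually_nhds, hg.eventually_analyticAt] with x hx hgx hxc
      have hQx : Q x ≠ 0 := eqn_ne_zero hxc le_rfl
      have hev : f =ᶠ[𝓝 x] fun y => g y * (Q y ^ N)⁻¹ := by
        filter_upwards [hx, (isOpen_conf L n).mem_nhds hxc] with y hy hyc
        rw [hy hyc, div_eq_mul_inv]
      have hd1 := hgx.differentiableAt.hasFDerivAt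
      have hd2 := (hQa x).differentiableAt.hasFDerivAt
      have hd3 := (hasDerivAt_inv (pow_ne_zero N hQx)).comp_hasFDerivAt x (hd2.pow N)
      have hd := (hd1.mul hd3).fderiv
      have hfd : fderiv ℂ f x = _ := hev.fderiv_eq.trans hd
      rw [partialFun, if_pos hxc, hfd]
      simp only [add_apply, smul_apply, smul_eq_mul,
        Function.comp, nsmul_eq_mul]
      change _ = (fderiv ℂ g x e * Q x - N * g x * fderiv ℂ Q x e) / Q x ^ (N + 1)
      rcases N with _ | N
      · simp [e]; field_simp
      · simp [e]
        field_simp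
        ring

/-- The derivation `∂_i`. -/
def partialReg (L : PeriodPair) {n : ℕ} (i : Fin n) : regFun L n →ₗ[ℂ] regFun L n where
  toFun f := ⟨partialFun L i f, partialFun_mem i f.2⟩
  map_add' f g := by
    ext x
    obtain ⟨N, hf⟩ := f.2.2.2
    obtain ⟨M, hg⟩ := g.2.2.2
    by_cases hx : x ∈ conf L n
    · simp [partialFun, hx, fderiv_add ((hf x).analyticAt hx).differentiableAt
        ((hg x).analyticAt hx).differentiableAt]
    · simp [partialFun, hx]
  map_smul' c f := by
    ext x
    obtain ⟨N, hf⟩ := f.2.2.2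
    by_cases hx : x ∈ conf L n
    · simp [partialFun, hx, fderiv_const_smul ((hf x).analyticAt hx).differentiableAt]
    · simp [partialFun, hx]


/-- The derivation `∂_i` of `Γ_n`. -/
def partialD (L : PeriodPair) {n : ℕ} (i : Fin n) : Gam L n →ₗ[ℂ] Gam L n := partialReg L i

/-- The coefficient of `t ^ m` in the Laurent expansion at `t = 0` of a function that is
meromorphic there, as the contour integral `(2πi)⁻¹ ∮ F(t) t^(-m-1) dt` over small circles. -/
def laurentCoeff (F : ℂ → ℂ) (m : ℤ) : ℂ :=
  limUnder (𝓝[>] (0 : ℝ)) fun r : ℝ =>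
    (2 * Real.pi * Complex.I)⁻¹ * ∮ t in C(0, r), F t * t ^ (-m - 1)

lemma laurentCoeff_eq {F G : ℂ → ℂ} {N : ℕ} (hG : AnalyticAt ℂ G 0)
    (h : ∀ᶠ t in 𝓝[≠] 0, F t = G t / t ^ N) (m : ℤ) :
    laurentCoeff F m = if 0 ≤ m + N then
      iteratedDeriv (m + N).toNat G 0 / ((m + N).toNat.factorial : ℂ) else 0 := by
  obtain ⟨ε, hε, hb⟩ := Metric.eventually_nhds_iff.1
    (hG.eventually_analyticAt.and (eventually_nhdsWithin_iff.1 h))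
  refine Tendsto.limUnder_eq (tendsto_const_nhds.congr' ?_)
  filter_upwards [Ioo_mem_nhdsGT hε] with r hr
  have hball : ∀ t ∈ Metric.closedBall (0 : ℂ) r, AnalyticAt ℂ G t := fun t ht =>
    (hb (lt_of_le_of_lt (Metric.mem_closedBall.1 ht) hr.2)).1
  have hdiff : DifferentiableOn ℂ G (Metric.closedBall 0 r) := fun t ht =>
    (hball t ht).differentiableAt.differentiableWithinAt
  have hint : (∮ t in C(0, r), F t * t ^ (-m - 1)) =
      ∮ t in C(0, r), G t * t ^ (-(m + N) - 1) := by
    refine circleIntegral.integral_congr hr.1.le fun t ht => ?_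
    have ht0 : t ≠ 0 := by
      rintro rfl
      simp at ht
      exact hr.1.ne ht
    have hFt : F t = G t / t ^ N := (hb (by
      rw [mem_sphere_iff_norm, sub_zero] at ht
      rw [dist_zero_right, ht]; exact hr.2)).2 ht0
    simp only [hFt]
    rw [div_mul_eq_mul_div, mul_div_assoc, ← zpow_natCast t N, ← zpow_sub₀ ht0]
    congr 2
    ring
  rw [hint]
  split_ifs with hm
  · obtain ⟨M, hM⟩ := Int.eq_ofNat_of_zero_le hm
    have := hdiff.circleIntegral_one_div_sub_center_pow_smul hr.1 M
    have h2 : (∮ t in C(0, r), G t * t ^ (-(m + N) - 1)) =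
        ∮ t in C(0, r), (1 / (t - 0) ^ (M + 1)) • G t := by
      refine circleIntegral.integral_congr hr.1.le fun t ht => ?_
      simp only [hM, sub_zero, smul_eq_mul]
      rw [mul_comm, show (-(M : ℤ) - 1) = -((M + 1 : ℕ) : ℤ) by push_cast; ring, zpow_neg,
        zpow_natCast, one_div]
    rw [h2, this, hM]
    have hpi : (2 * Real.pi * Complex.I : ℂ) ≠ 0 := Complex.two_pi_I_ne_zero
    simp only [Int.toNat_natCast, smul_eq_mul]
    field_simp
  · obtain ⟨M, hM⟩ := Int.eq_ofNat_of_zero_le (show 0 ≤ -(m + N) - 1 by omega)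
    have h2 : (∮ t in C(0, r), G t * t ^ (-(m + N) - 1)) = 0 := by
      simp only [hM, zpow_natCast]
      refine Complex.circleIntegral_eq_zero_of_differentiable_on_off_countable hr.1.le
        Set.countable_empty (hdiff.continuousOn.mul (continuousOn_id.pow M)) ?_
      rintro t ⟨ht, -⟩
      exact (hball t (Metric.ball_subset_closedBall ht)).differentiableAt.mul
        (differentiableAt_id.pow M)
    rw [h2, mul_zero]

/-- The point of `ℂ^(n+1)` whose `i`-th coordinate is `x_k + t`, where `x_{n+1} = 0`, and whose
remaining coordinates are, in order, `x_1, …, x_n`. -/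
def ins {n : ℕ} (i k : Fin (n + 1)) (x : Fin n → ℂ) (t : ℂ) : Fin (n + 1) → ℂ :=
  Fin.insertNth (α := fun _ => ℂ) i (pts x k + t) x

/-- The relabelling of indices after `i` has been merged with `i.succAbove k`. -/
def mrg {n : ℕ} (i k : Fin (n + 1)) : Fin (n + 2) → Fin (n + 1) :=
  Fin.insertNth (α := fun _ => Fin (n + 1)) i.castSucc k id

lemma pts_ins {n : ℕ} (i k : Fin (n + 1)) (x : Fin n → ℂ) (t : ℂ) (a : Fin (n + 2)) :
    pts (ins i k x t) a = pts x (mrg i k a) + t * (if a = i.castSucc then 1 else 0) := by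
  rcases Fin.eq_self_or_eq_succAbove i.castSucc a with rfl | ⟨l, rfl⟩
  · simp [ins, mrg]
  · simp only [mrg, Fin.insertNth_apply_succAbove, id, Fin.succAbove_ne, if_false, mul_zero,
      add_zero]
    induction l using Fin.lastCases with
    | last => simp
    | cast l =>
      rw [Fin.castSucc_succAbove_castSucc, pts_castSucc, pts_castSucc, ins,
        Fin.insertNth_apply_succAbove]

lemma mrg_eq {n : ℕ} {i k : Fin (n + 1)} {a b : Fin (n + 2)} (hab : a ≠ b)
    (h : mrg i k a = mrg i k b) :
    (if a = i.castSucc then 1 else 0 : ℂ) - (if b = i.castSucc then 1 else 0) = 1 ∨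
    (if a = i.castSucc then 1 else 0 : ℂ) - (if b = i.castSucc then 1 else 0) = -1 := by
  rcases Fin.eq_self_or_eq_succAbove i.castSucc a with rfl | ⟨l, rfl⟩
  · simp [hab.symm]
  · rcases Fin.eq_self_or_eq_succAbove i.castSucc b with rfl | ⟨l', rfl⟩
    · simp
    · simp [mrg] at h
      exact absurd (by rw [h]) hab

lemma eventually_ins_mem_conf {L : PeriodPair} {n : ℕ} (i k : Fin (n + 1)) {x : Fin n → ℂ}
    (hx : x ∈ conf L n) : ∀ᶠ t in 𝓝[≠] (0 : ℂ), ins i k x t ∈ conf L (n + 1) := by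
  simp only [conf, Set.mem_ofPred_eq, eventually_all]
  intro a b hab
  set e : ℂ := (if a = i.castSucc then 1 else 0 : ℂ) - (if b = i.castSucc then 1 else 0) with he
  have key : ∀ t, pts (ins i k x t) a - pts (ins i k x t) b =
      (pts x (mrg i k a) - pts x (mrg i k b)) + t * e := by
    intro t; rw [pts_ins, pts_ins, he]; ring
  simp only [key]
  by_cases h : mrg i k a = mrg i k b
  · have hsmall : ∀ᶠ t in 𝓝[≠] (0 : ℂ), t ∉ L.lattice := by
      rw [eventually_nhdsWithin_iff]
      filter_upwards [L.compl_lattice_sdiff_singleton_mem_nhds 0] with t ht ht0 hL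
      exact ht ⟨hL, ht0⟩
    filter_upwards [hsmall] with t ht
    rcases mrg_eq hab h with h1 | h1
    · rw [h, he, h1]; simpa using ht
    · rw [h, he, h1]; simpa using ht
  · refine eventually_nhdsWithin_of_eventually_nhds ?_
    have hc : ContinuousAt (fun t : ℂ => (pts x (mrg i k a) - pts x (mrg i k b)) + t * e) 0 := by
      fun_prop
    refine hc.eventually_mem (L.isClosed_lattice.isOpen_compl.mem_nhds ?_)
    simpa using hx _ _ h

lemma analyticAt_ins {n : ℕ} (i k : Fin (n + 1)) (z : (Fin n → ℂ) × ℂ) :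
    AnalyticAt ℂ (fun z : (Fin n → ℂ) × ℂ => ins i k z.1 z.2) z := by
  rw [analyticAt_pi_iff]
  intro a
  have : (fun z : (Fin n → ℂ) × ℂ => ins i k z.1 z.2 a) = fun z =>
      pts z.1 (mrg i k a.castSucc) + z.2 * (if a.castSucc = i.castSucc then 1 else 0) := by
    funext z
    rw [← pts_ins, pts_castSucc]
  rw [this]
  exact ((analyticAt_pts _ _).comp analyticAt_fst).add (analyticAt_snd.mul analyticAt_const)

lemma iteratedDeriv_div {E : Type*} [NormedAddCommGroup E] [NormedSpace ℂ E] [CompleteSpace E]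
    {P : E} {g R : E × ℂ → ℂ}
    (hg : AnalyticAt ℂ g (P, 0)) (hR : AnalyticAt ℂ R (P, 0)) (M : ℕ) :
    ∃ G : E × ℂ → ℂ, AnalyticAt ℂ G (P, 0) ∧ ∀ᶠ z in 𝓝 (P, (0 : ℂ)), R z ≠ 0 →
      iteratedDeriv M (fun s => g (z.1, s) / R (z.1, s)) z.2 = G z / R z ^ (M + 1) := by
  induction M with
  | zero => exact ⟨g, hg, Eventually.of_forall fun z _ => by simp⟩
  | succ M ih =>
    obtain ⟨G, hG, h⟩ := ih
    let e : E × ℂ := (0, 1)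
    have hda : ∀ k : E × ℂ → ℂ, AnalyticAt ℂ k (P, 0) →
        AnalyticAt ℂ (fun x => fderiv ℂ k x e) (P, 0) := fun k hk =>
      ((ContinuousLinearMap.apply ℂ ℂ e).analyticAt _).comp hk.fderiv
    refine ⟨fun z => fderiv ℂ G z e * R z - (M + 1) * G z * fderiv ℂ R z e,
      ((hda G hG).mul hR).sub ((analyticAt_const.mul hG).mul (hda R hR)), ?_⟩
    filter_upwards [h.eventually_nhds, hG.eventually_analyticAt, hR.eventually_analyticAt] with
      z hz hGz hRz hRz0
    have hline : ∀ k : E × ℂ → ℂ, AnalyticAt ℂ k z →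
        HasDerivAt (fun s => k (z.1, s)) (fderiv ℂ k z e) z.2 := by
      intro k hk
      have h1 : HasDerivAt (fun s : ℂ => (z.1, s)) e z.2 :=
        (hasDerivAt_const z.2 z.1).prodMk (hasDerivAt_id z.2)
      exact hk.differentiableAt.hasFDerivAt.comp_hasDerivAt_of_eq z.2 h1 rfl
    have hct : ContinuousAt (fun s : ℂ => (z.1, s)) z.2 := by fun_prop
    have hev : (iteratedDeriv M fun s => g (z.1, s) / R (z.1, s)) =ᶠ[𝓝 z.2]
        fun s => G (z.1, s) / R (z.1, s) ^ (M + 1) := by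
      filter_upwards [hct.eventually hz,
        hct.eventually (hRz.continuousAt.eventually_ne hRz0)] with s hs hs0
      exact hs hs0
    rw [iteratedDeriv_succ, hev.deriv_eq]
    have := (hline G hGz).div ((hline R hRz).pow (M + 1)) (pow_ne_zero _ hRz0)
    refine this.deriv.trans ?_
    simp only [Pi.pow_apply, Prod.mk.eta, Nat.cast_add, Nat.cast_one, add_tsub_cancel_right]
    field_simp
    ring

lemma inv_lin_aux {L : PeriodPair} {n : ℕ} {P : Fin n → ℂ} {a b : Fin (n + 1)} (hab : a ≠ b)
    (h : lin (a, b) P ∈ L.lattice) :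
    (∀ x ∈ conf L n, lin (a, b) (x - P) ≠ 0) ∧
      PoleAt L 1 P (fun x => (lin (a, b) (x - P))⁻¹) := by
  classical
  rcases lt_or_gt_of_ne hab with hlt | hlt
  · have hp : (a, b) ∈ divAt L P := by simp [divAt, hlt, h]
    exact ⟨fun x hx => lin_ne_zero hx hp, PoleAt.inv_lin hp⟩
  · have hneg : ∀ x, lin (a, b) x = - lin (b, a) x := fun x => by simp [lin]
    have hp : (b, a) ∈ divAt L P := by
      simp only [divAt, Finset.mem_filter, Finset.mem_univ, hlt, true_and]
      rw [hneg] at h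
      simpa using neg_mem h
    refine ⟨fun x hx => by rw [hneg]; exact neg_ne_zero.2 (lin_ne_zero hx hp), ?_⟩
    have := (AnalyticAt.poleAt (L := L) (f := fun _ => (-1 : ℂ)) (P := P) analyticAt_const).mul
      (PoleAt.inv_lin hp)
    rw [zero_add] at this
    refine this.congr (Eventually.of_forall fun x _ => ?_)
    simp [hneg, inv_neg]

/-- The local shape of `f` near a point of the divisor that is being approached. -/
lemma PoleAt.ins_form {L : PeriodPair} {n N : ℕ} (i k : Fin (n + 1)) {P : Fin n → ℂ} {f}
    (h : PoleAt L N (ins i k P 0) f) :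
    ∃ g R : (Fin n → ℂ) × ℂ → ℂ, AnalyticAt ℂ g (P, 0) ∧ AnalyticAt ℂ R (P, 0) ∧
      (∀ᶠ z in 𝓝 (P, (0 : ℂ)), z.2 ≠ 0 → ins i k z.1 z.2 ∈ conf L (n + 1) →
        f (ins i k z.1 z.2) = g z / R z / z.2 ^ ((n + 2) ^ 2 * N)) ∧
      (∀ x ∈ conf L n, R (x, 0) ≠ 0) ∧
      PoleAt L ((n + 2) ^ 2 * N) P (fun x => (R (x, 0))⁻¹) := by
  classical
  obtain ⟨g, hg, hf⟩ := h
  set D := divAt L (ins i k P 0) with hD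
  let e : Fin (n + 2) × Fin (n + 2) → ℂ := fun p =>
    (if p.1 = i.castSucc then 1 else 0 : ℂ) - (if p.2 = i.castSucc then 1 else 0)
  have hlin : ∀ p (z : (Fin n → ℂ) × ℂ), lin p (ins i k z.1 z.2 - ins i k P 0) =
      lin (mrg i k p.1, mrg i k p.2) (z.1 - P) + z.2 * e p := by
    intro p z
    simp only [lin, pts_sub, pts_ins, e]
    ring
  let S := D.filter fun p => mrg i k p.1 = mrg i k p.2
  let T := D.filter fun p => ¬ mrg i k p.1 = mrg i k p.2
  have hcard : ∀ U ⊆ D, U.card ≤ (n + 2) ^ 2 := fun U _ => by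
    calc U.card ≤ Fintype.card (Fin (n + 1 + 1) × Fin (n + 1 + 1)) := Finset.card_le_univ _
      _ = (n + 2) ^ 2 := by simp [sq]
  have hS : ∀ p ∈ S, e p = 1 ∨ e p = -1 := by
    intro p hp
    simp only [S, Finset.mem_filter, hD, divAt, Finset.mem_univ, true_and] at hp
    exact mrg_eq hp.1.1.ne hp.2
  have hT : ∀ p ∈ T, mrg i k p.1 ≠ mrg i k p.2 ∧
      lin (mrg i k p.1, mrg i k p.2) P ∈ L.lattice := by
    intro p hp
    simp only [T, Finset.mem_filter, hD, divAt, Finset.mem_univ, true_and] at hp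
    refine ⟨hp.2, ?_⟩
    have := hp.1.2
    simpa [lin, pts_ins] using this
  have hc0 : ∏ p ∈ S, e p ≠ 0 := Finset.prod_ne_zero_iff.2 fun p hp => by
    rcases hS p hp with h | h <;> rw [h] <;> norm_num
  let R : (Fin n → ℂ) × ℂ → ℂ := fun z =>
    ((∏ p ∈ S, e p) * ∏ p ∈ T, lin p (ins i k z.1 z.2 - ins i k P 0)) ^ N
  have heq : ∀ z : (Fin n → ℂ) × ℂ, eqn D (ins i k P 0) (ins i k z.1 z.2) ^ N =
      R z * z.2 ^ (S.card * N) := by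
    intro z
    have h1 : ∏ p ∈ S, lin p (ins i k z.1 z.2 - ins i k P 0) = (∏ p ∈ S, e p) * z.2 ^ S.card := by
      rw [← Finset.prod_const, ← Finset.prod_mul_distrib]
      refine Finset.prod_congr rfl fun p hp => ?_
      rw [hlin, (Finset.mem_filter.1 hp).2]
      simp [lin, mul_comm]
    rw [eqn, ← Finset.prod_filter_mul_prod_filter_not D fun p => mrg i k p.1 = mrg i k p.2]
    change ((∏ p ∈ S, _) * ∏ p ∈ T, _) ^ N = _
    rw [h1, pow_mul, ← mul_pow]
    congr 1
    ring
  have hins := analyticAt_ins i k (P, (0 : ℂ))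
  refine ⟨fun z => g (ins i k z.1 z.2) * z.2 ^ ((n + 2) ^ 2 * N - S.card * N), R,
    (AnalyticAt.fun_comp (f := fun z : (Fin n → ℂ) × ℂ => ins i k z.1 z.2) (x := (P, 0)) hg hins).mul (analyticAt_snd.pow _), ?_, ?_, ?_, ?_⟩
  · refine (analyticAt_const.mul (Finset.analyticAt_fun_prod _ fun p _ => ?_)).pow N
    exact AnalyticAt.fun_comp (f := fun z : (Fin n → ℂ) × ℂ => ins i k z.1 z.2) (x := (P, 0))
      (analyticAt_lin p _ _) hins
  · have := hins.continuousAt.eventually hf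
    filter_upwards [this] with z hz hz0 hzc
    rw [hz hzc, heq]
    have hle : S.card * N ≤ (n + 2) ^ 2 * N :=
      Nat.mul_le_mul_right _ (hcard S (Finset.filter_subset _ _))
    have hR : R z ≠ 0 := by
      intro h0
      have h1 := heq z
      rw [h0, zero_mul] at h1
      by_cases hN : N = 0
      · subst hN; simp at h1
      · exact eqn_ne_zero hzc (le_refl D) (by simpa [hN] using h1)
    rw [div_div, div_eq_div_iff (mul_ne_zero hR (pow_ne_zero _ hz0))
      (mul_ne_zero hR (pow_ne_zero _ hz0)), ← Nat.sub_add_cancel hle, pow_add]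
    simp only [Nat.sub_add_cancel hle]
    ring
  · intro x hx
    refine pow_ne_zero _ (mul_ne_zero hc0 (Finset.prod_ne_zero_iff.2 fun p hp => ?_))
    have := (inv_lin_aux (hT p hp).1 (hT p hp).2).1 x hx
    rw [hlin p (x, 0)]
    simpa using this
  · have hp := (PoleAt.prod (L := L) (P := P) T 1 (fun p x =>
      (lin (mrg i k p.1, mrg i k p.2) (x - P))⁻¹)
      fun p hp => (inv_lin_aux (hT p hp).1 (hT p hp).2).2)
    have h2 := ((AnalyticAt.poleAt (L := L) (f := fun _ => (∏ p ∈ S, e p)⁻¹) (P := P)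
      analyticAt_const).mul hp).pow N
    have hle : (0 + T.card * 1) * N ≤ (n + 2) ^ 2 * N := by
      rw [zero_add, mul_one]
      exact Nat.mul_le_mul_right _ (hcard T (Finset.filter_subset _ _))
    refine (h2.mono hle).congr (Eventually.of_forall fun x _ => ?_)
    simp only [R, hlin _ (x, (0 : ℂ))]
    simp only [Pi.pow_apply, Pi.mul_apply, Finset.prod_apply, Finset.prod_inv_distrib, zero_mul,
      add_zero]
    rw [← mul_inv, inv_pow]

open Classical in
/-- The coefficient `f^(m)` of `(x_i - x_j)^m`, `j = i.succAbove k`, in the Laurent expansion of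
`f(x_1, …, x_{n+1})` in the variable `x_i` at `x_i = x_j` (at `x_i = 0` if `j = n + 2`), as a
function of the remaining variables, renamed `x_1, …, x_n`. -/
def coeffFun (L : PeriodPair) {n : ℕ} (i k : Fin (n + 1)) (m : ℤ) (f : (Fin (n + 1) → ℂ) → ℂ)
    (x : Fin n → ℂ) : ℂ :=
  if x ∈ conf L n then laurentCoeff (fun t => f (ins i k x t)) m else 0

lemma exists_laurent {L : PeriodPair} {n N : ℕ} (i k : Fin (n + 1)) {f}
    (hN : ∀ P, PoleAt L N P f) {x : Fin n → ℂ} (hx : x ∈ conf L n) :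
    ∃ G : ℂ → ℂ, AnalyticAt ℂ G 0 ∧
      ∀ᶠ t in 𝓝[≠] 0, f (ins i k x t) = G t / t ^ ((n + 2) ^ 2 * N) := by
  obtain ⟨g, R, hg, hR, h, hR0, -⟩ := (hN (ins i k x 0)).ins_form i k
  have hl : AnalyticAt ℂ (fun t : ℂ => (x, t)) 0 := analyticAt_const.prod analyticAt_id
  refine ⟨fun t => g (x, t) / R (x, t), (AnalyticAt.fun_comp (g := g) hg hl).div
    (AnalyticAt.fun_comp (g := R) hR hl) (hR0 x hx), ?_⟩
  have hct : ContinuousAt (fun s : ℂ => (x, s)) 0 := by fun_prop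
  filter_upwards [eventually_ins_mem_conf i k hx, self_mem_nhdsWithin,
    eventually_nhdsWithin_of_eventually_nhds (hct.eventually h)] with t h1 h2 h3
  exact h3 h2 h1

lemma coeffFun_mem {L : PeriodPair} {n : ℕ} (i k : Fin (n + 1)) (m : ℤ) {f}
    (hf : f ∈ regFun L (n + 1)) : coeffFun L i k m f ∈ regFun L n := by
  obtain ⟨h1, h2, N, h3⟩ := hf
  set B := (n + 2) ^ 2 * N with hB
  refine ⟨fun x hx => if_neg hx, fun x v hv => ?_, B * ((m + B).toNat + 1), fun P => ?_⟩
  · classical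
    refine if_congr (add_mem_conf hv) ?_ rfl
    congr 1
    funext t
    rw [← h2 (ins i k x t) (ins i k v 0)]
    · congr 1
      funext a
      refine Fin.succAboveCases i ?_ (fun l => ?_) a
      · simp [ins, pts_add]; ring
      · simp [ins]
    · intro a
      refine Fin.succAboveCases i ?_ (fun l => ?_) a
      · simp only [ins, Fin.insertNth_apply_same, add_zero]
        induction k using Fin.lastCases <;> simp [hv]
      · simp [ins, hv]
  · obtain ⟨g, R, hg, hR, h, hR0, hRp⟩ := (h3 (ins i k P 0)).ins_form i k
    obtain ⟨G, hG, hGe⟩ := iteratedDeriv_div hg hR (m + B).toNat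
    have hl : AnalyticAt ℂ (fun x : Fin n → ℂ => (x, (0 : ℂ))) P :=
      analyticAt_id.prod analyticAt_const
    have hct : ContinuousAt (fun x : Fin n → ℂ => (x, (0 : ℂ))) P := by fun_prop
    by_cases hm : 0 ≤ m + B
    · have hP := ((AnalyticAt.poleAt (L := L) (P := P) (f := fun x => G (x, 0) /
        ((m + B).toNat.factorial : ℂ)) ((AnalyticAt.fun_comp (f := fun x : Fin n → ℂ => (x, (0 : ℂ))) (x := P) hG hl).div_const)).mul
        (hRp.pow ((m + B).toNat + 1)))
      rw [zero_add] at hP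
      refine hP.congr ?_
      filter_upwards [hct.eventually hGe, hct.eventually h.eventually_nhds,
        hct.eventually hg.eventually_analyticAt, hct.eventually hR.eventually_analyticAt]
        with x hx1 hx2 hx3 hx4 hx
      have hlt : AnalyticAt ℂ (fun t : ℂ => (x, t)) 0 := analyticAt_const.prod analyticAt_id
      have hctt : ContinuousAt (fun s : ℂ => (x, s)) 0 := by fun_prop
      rw [coeffFun, if_pos hx, laurentCoeff_eq (G := fun t => g (x, t) / R (x, t)) (N := B)
        ((AnalyticAt.fun_comp (g := g) hx3 hlt).div (AnalyticAt.fun_comp (g := R) hx4 hlt) (hR0 x hx)) ?_,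
        if_pos hm, hx1 (hR0 x hx)]
      · simp only [Pi.mul_apply, Pi.pow_apply, inv_pow]
        field_simp
      · filter_upwards [eventually_ins_mem_conf i k hx, self_mem_nhdsWithin,
          eventually_nhdsWithin_of_eventually_nhds (hctt.eventually hx2)] with t k1 k2 k3
        exact k3 k2 k1
    · have h0 := (AnalyticAt.poleAt (L := L) (P := P) (f := fun _ => 0) analyticAt_const).mono
        (Nat.zero_le (B * ((m + B).toNat + 1)))
      refine h0.congr (Eventually.of_forall fun x hx => ?_)
      obtain ⟨G', hG', hG'e⟩ := exists_laurent i k h3 hx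
      rw [coeffFun, if_pos hx, laurentCoeff_eq hG' hG'e, if_neg hm]

/-- The map `f ↦ f^(m)`. -/
def coeffReg (L : PeriodPair) {n : ℕ} (i k : Fin (n + 1)) (m : ℤ) :
    regFun L (n + 1) →ₗ[ℂ] regFun L n where
  toFun f := ⟨coeffFun L i k m f, coeffFun_mem i k m f.2⟩
  map_add' f f' := by
    ext x
    obtain ⟨N, hN⟩ := f.2.2.2
    obtain ⟨M, hM⟩ := f'.2.2.2
    by_cases hx : x ∈ conf L n
    · obtain ⟨G, hG, h⟩ := exists_laurent i k
        (fun P => (hN P).mono (le_max_left N M)) hx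
      obtain ⟨G', hG', h'⟩ := exists_laurent i k
        (fun P => (hM P).mono (le_max_right N M)) hx
      have hadd : ∀ᶠ t in 𝓝[≠] 0, ((f + f' : regFun L (n + 1)) : (Fin (n + 1) → ℂ) → ℂ)
          (ins i k x t) = (G + G') t / t ^ ((n + 2) ^ 2 * max N M) := by
        filter_upwards [h, h'] with t ht ht'
        simp [ht, ht', add_div]
      simp only [coeffFun, if_pos hx, Submodule.coe_add, Pi.add_apply]
      simp only [Submodule.coe_add, Pi.add_apply] at hadd
      rw [laurentCoeff_eq hG h, laurentCoeff_eq hG' h', laurentCoeff_eq (hG.add hG') hadd]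
      split_ifs
      · rw [iteratedDeriv_add hG.contDiffAt hG'.contDiffAt, add_div]
      · simp
    · simp [coeffFun, hx]
  map_smul' c f := by
    ext x
    obtain ⟨N, hN⟩ := f.2.2.2
    by_cases hx : x ∈ conf L n
    · obtain ⟨G, hG, h⟩ := exists_laurent i k hN hx
      have hsm : ∀ᶠ t in 𝓝[≠] 0, ((c • f : regFun L (n + 1)) : (Fin (n + 1) → ℂ) → ℂ)
          (ins i k x t) = (c • G) t / t ^ ((n + 2) ^ 2 * N) := by
        filter_upwards [h] with t ht
        simp [ht, mul_div_assoc]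
      simp only [coeffFun, if_pos hx, Submodule.coe_smul, Pi.smul_apply, RingHom.id_apply,
        smul_eq_mul]
      simp only [Submodule.coe_smul, Pi.smul_apply, smul_eq_mul] at hsm
      rw [laurentCoeff_eq hG h, laurentCoeff_eq (hG.const_smul (c := c)) hsm]
      split_ifs
      · rw [iteratedDeriv_const_smul_field]; simp [mul_div_assoc]
      · simp
    · simp [coeffFun, hx]

/-- The map `f ↦ f^(m)` from `Γ_{n+1}` to `Γ_n`. -/
def coeff (L : PeriodPair) {n : ℕ} (i k : Fin (n + 1)) (m : ℤ) :
    Gam L (n + 1) →ₗ[ℂ] Gam L n := coeffReg L i k m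

lemma coeff_eq_zero {L : PeriodPair} {n : ℕ} (i k : Fin (n + 1)) (f : Gam L (n + 1)) :
    ∃ M : ℤ, ∀ m < M, coeff L i k m f = 0 := by
  obtain ⟨N, hN⟩ := f.2.2.2
  refine ⟨-((n + 2) ^ 2 * N : ℕ), fun m hm => ?_⟩
  refine Subtype.ext (funext fun x => ?_)
  by_cases hx : x ∈ conf L n
  · obtain ⟨G, hG, h⟩ := exists_laurent i k hN hx
    change coeffFun L i k m f.1 x = 0
    rw [coeffFun, if_pos hx, laurentCoeff_eq hG h, if_neg (by omega)]
  · change coeffFun L i k m f.1 x = 0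
    rw [coeffFun, if_neg hx]

/-- The subspace `G_q Γ_n`: the functions `f` that locally on `E^n` are sums of products of at most
`q + n` functions, each having poles along a single one of the divisors. Locally at `P` such a sum
is a sum of functions `h / ∏_{D ∈ S} (equation of D)^N` with `h` holomorphic at `P` and `S` a set
of at most `q + n` of the divisors through `P`. -/
def filGam (L : PeriodPair) (n : ℕ) (q : ℤ) : Submodule ℂ (Gam L n) where
  carrier := {f | ∀ P : Fin n → ℂ,
    ∃ g ∈ Submodule.span ℂ {g : (Fin n → ℂ) → ℂ |
        ∃ S ⊆ divAt L P, (S.card : ℤ) ≤ q + n ∧ ∃ (h : (Fin n → ℂ) → ℂ) (N : ℕ),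
          AnalyticAt ℂ h P ∧ g = fun x => h x / eqn S P x ^ N},
      ∀ᶠ x in 𝓝 P, x ∈ conf L n → f.1 x = g x}
  zero_mem' := fun _ => ⟨0, zero_mem _, Eventually.of_forall fun _ _ => rfl⟩
  add_mem' := by
    intro f f' hf hf' P
    obtain ⟨g, hg, h⟩ := hf P
    obtain ⟨g', hg', h'⟩ := hf' P
    refine ⟨g + g', add_mem hg hg', ?_⟩
    filter_upwards [h, h'] with x hx hx' hxc
    change f.1 x + f'.1 x = g x + g' x
    rw [hx hxc, hx' hxc]
  smul_mem' := by
    intro c f hf P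
    obtain ⟨g, hg, h⟩ := hf P
    refine ⟨c • g, Submodule.smul_mem _ c hg, ?_⟩
    filter_upwards [h] with x hx hxc
    change c * f.1 x = c * g x
    rw [hx hxc]

/-- A vertex algebra structure on a complex vector space, with products `a_(n) b = mul n a b`.
In the Borcherds identity only finitely many summands are nonzero, by `truncation`. -/
structure VertexAlgebra (V : Type*) [AddCommGroup V] [Module ℂ V] where
  mul : ℤ → V →ₗ[ℂ] V →ₗ[ℂ] V
  vac : V
  vac_ne_zero : vac ≠ 0
  truncation : ∀ a b, ∃ N : ℤ, ∀ n, N ≤ n → mul n a b = 0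
  vac_mul : ∀ n b, mul n vac b = if n = -1 then b else 0
  mul_vac_nonneg : ∀ a n, 0 ≤ n → mul n a vac = 0
  mul_vac : ∀ a, mul (-1) a vac = a
  borcherds : ∀ (a b c : V) (m n k : ℤ),
    ∑ᶠ j : ℕ, Ring.choose m j • mul (m + k - j) (mul (n + j) a b) c =
    ∑ᶠ j : ℕ, ((-1 : ℤ) ^ j * Ring.choose n j) •
      (mul (n + m - j) a (mul (k + j) b c)
        - (n.negOnePow : ℤ) • mul (n + k - j) b (mul (m + j) a c))

namespace VertexAlgebra

variable {V : Type*} [AddCommGroup V] [Module ℂ V]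

/-- The translation operator `T a = a_(-2) 1`. -/
def trans (A : VertexAlgebra V) : V →ₗ[ℂ] V := (A.mul (-2)).flip A.vac

end VertexAlgebra

/-- A graded vertex algebra: `V = ⨁_{n ≥ 0} V_n` with `a_(n) b` of degree `Δ(a) + Δ(b) - n - 1`
(in particular `a_(n) b = 0` if this number is negative). -/
structure GradedVertexAlgebra (V : Type*) [AddCommGroup V] [Module ℂ V] extends
    VertexAlgebra V where
  deg : ℕ → Submodule ℂ V
  isInternal : DirectSum.IsInternal deg
  vac_mem : vac ∈ deg 0
  trans_mem : ∀ n, ∀ a ∈ deg n, toVertexAlgebra.trans a ∈ deg (n + 1)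
  mul_mem : ∀ (p q : ℕ) (n : ℤ), ∀ a ∈ deg p, ∀ b ∈ deg q, ∀ r : ℕ,
    (r : ℤ) = p + q - n - 1 → mul n a b ∈ deg r
  mul_eq_zero : ∀ (p q : ℕ) (n : ℤ), ∀ a ∈ deg p, ∀ b ∈ deg q,
    (p : ℤ) + q - n - 1 < 0 → mul n a b = 0

/-- A good increasing filtration of a vertex algebra. -/
structure GoodFiltration {V : Type*} [AddCommGroup V] [Module ℂ V] (A : VertexAlgebra V) where
  fil : ℤ → Submodule ℂ V
  mono : Monotone fil
  exhaustive : ∀ v, ∃ p, v ∈ fil p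
  mul_mem : ∀ (p q : ℤ), ∀ a ∈ fil p, ∀ b ∈ fil q, ∀ n : ℤ, A.mul n a b ∈ fil (p + q)
  mul_mem_of_nonneg : ∀ (p q : ℤ), ∀ a ∈ fil p, ∀ b ∈ fil q, ∀ n : ℤ, 0 ≤ n →
    A.mul n a b ∈ fil (p + q - 1)

section Complex

open scoped TensorProduct

variable {V : Type*} [AddCommGroup V] [Module ℂ V]

/-- `a^1 ⊗ ⋯ ⊗ a^(n+2)` is sent to the tensor obtained by replacing `a^j`, where
`j = i.succAbove k`, by `a^i_(m) a^j` and omitting `a^i`. -/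
def merge (A : VertexAlgebra V) {n : ℕ} (i k : Fin (n + 1)) (m : ℤ) :
    (⨂[ℂ] _ : Fin (n + 2), V) →ₗ[ℂ] (⨂[ℂ] _ : Fin (n + 1), V) :=
  PiTensorProduct.lift <| MultilinearMap.mk'
    (fun v : Fin (n + 2) → V => PiTensorProduct.tprod ℂ
      (Function.update (fun l => v (i.castSucc.succAbove l)) k
        (A.mul m (v i.castSucc) (v (i.castSucc.succAbove k)))))
    (by
      intro v a x y
      rcases Fin.eq_self_or_eq_succAbove i.castSucc a with rfl | ⟨l, rfl⟩
      · simp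
      · have hup : ∀ z, (fun l' => Function.update v (i.castSucc.succAbove l) z
            (i.castSucc.succAbove l')) =
            Function.update (fun l' => v (i.castSucc.succAbove l')) l z := fun z =>
          Function.update_comp_eq_of_injective v Fin.succAbove_right_injective l z
        simp only [hup]
        rw [Function.update_of_ne (Fin.succAbove_ne _ _).symm,
          Function.update_of_ne (Fin.succAbove_ne _ _).symm,
          Function.update_of_ne (Fin.succAbove_ne _ _).symm]
        by_cases hl : l = k
        · subst hl
          simp
        · have hne : i.castSucc.succAbove k ≠ i.castSucc.succAbove l := by
            simpa using fun h => hl h.symm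
          simp only [Function.update_of_ne hne, Function.update_comm hl]
          simp)
    (by
      intro v a c x
      rcases Fin.eq_self_or_eq_succAbove i.castSucc a with rfl | ⟨l, rfl⟩
      · simp
      · have hup : ∀ z, (fun l' => Function.update v (i.castSucc.succAbove l) z
            (i.castSucc.succAbove l')) =
            Function.update (fun l' => v (i.castSucc.succAbove l')) l z := fun z =>
          Function.update_comp_eq_of_injective v Fin.succAbove_right_injective l z
        simp only [hup]
        rw [Function.update_of_ne (Fin.succAbove_ne _ _).symm,
          Function.update_of_ne (Fin.succAbove_ne _ _).symm]
        by_cases hl : l = k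
        · subst hl
          simp
        · have hne : i.castSucc.succAbove k ≠ i.castSucc.succAbove l := by
            simpa using fun h => hl h.symm
          simp only [Function.update_of_ne hne, Function.update_comm hl]
          simp)

lemma merge_eq_zero (A : VertexAlgebra V) {n : ℕ} (i k : Fin (n + 1))
    (w : ⨂[ℂ] _ : Fin (n + 2), V) : ∃ M : ℤ, ∀ m, M ≤ m → merge A i k m w = 0 := by
  induction w using PiTensorProduct.induction_on with
  | smul_tprod r v =>
    obtain ⟨N, hN⟩ := A.truncation (v i.castSucc) (v (i.castSucc.succAbove k))
    refine ⟨N, fun m hm => ?_⟩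
    rw [map_smul, merge, PiTensorProduct.lift.tprod]
    simp [hN m hm]
  | add x y hx hy =>
    obtain ⟨N, hN⟩ := hx
    obtain ⟨M, hM⟩ := hy
    refine ⟨max N M, fun m hm => ?_⟩
    rw [map_add, hN m (le_trans (le_max_left _ _) hm), hM m (le_trans (le_max_right _ _) hm),
      add_zero]

lemma finite_support (L : PeriodPair) (A : VertexAlgebra V) {n : ℕ} (i k : Fin (n + 1))
    (f : Gam L (n + 1)) (w : ⨂[ℂ] _ : Fin (n + 2), V) :
    (Function.support fun m : ℤ => coeff L i k m f ⊗ₜ[ℂ] merge A i k m w).Finite := by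
  obtain ⟨M, hM⟩ := coeff_eq_zero i k f
  obtain ⟨N, hN⟩ := merge_eq_zero A i k w
  refine (Set.finite_Ico M N).subset fun m hm => ?_
  by_contra h
  rw [Set.mem_Ico, not_and_or, not_le, not_lt] at h
  rcases h with h | h
  · exact hm (by simp [hM m h])
  · exact hm (by simp [hN m h])

/-- `\tilde C_n = Γ_n ⊗ V^{⊗ (n+1)}`. -/
abbrev Ct (L : PeriodPair) (V : Type*) [AddCommGroup V] [Module ℂ V] (n : ℕ) : Type _ :=
  Gam L n ⊗[ℂ] (⨂[ℂ] _ : Fin (n + 1), V)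

/-- The residue map `f ⊗ a^1 ⊗ ⋯ ⊗ a^(n+2) ↦ ∑_m f^(m) ⊗ (⋯ ⊗ a^i_(m) a^j ⊗ ⋯)`, with `a^i`
omitted and `j = i.succAbove k`: the residue at `x_i = x_j` of `f ⊗ ⋯ ⊗ Y(a^i, x_i - x_j) a^j ⊗ ⋯`
if `j ≤ n + 1`, and the residue at `x_i = 0` of `f ⊗ ⋯ ⊗ Y(a^i, x_i) a^(n+2)` if `j = n + 2`. -/
def resMap (L : PeriodPair) (A : VertexAlgebra V) {n : ℕ} (i k : Fin (n + 1)) :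
    Ct L V (n + 1) →ₗ[ℂ] Ct L V n :=
  TensorProduct.lift <| LinearMap.mk₂ ℂ
    (fun f w => ∑ᶠ m : ℤ, coeff L i k m f ⊗ₜ[ℂ] merge A i k m w)
    (fun f f' w => by
      rw [← finsum_add_distrib (finite_support L A i k f w) (finite_support L A i k f' w)]
      simp [TensorProduct.add_tmul])
    (fun c f w => by
      rw [smul_finsum' c (finite_support L A i k f w)]
      simp [TensorProduct.smul_tmul'])
    (fun f w w' => by
      rw [← finsum_add_distrib (finite_support L A i k f w) (finite_support L A i k f w')]
      simp [TensorProduct.tmul_add])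
    (fun c f w => by
      rw [smul_finsum' c (finite_support L A i k f w)]
      simp)

/-- The map `d : \tilde C_{n+1} → \tilde C_n`, the sum over `1 ≤ i < j ≤ n + 2`, `i ≤ n + 1`, of
`(-1)^(n+1-i)` times the residue maps. Here `i` is counted from `0` and `j = i.succAbove k`, so that
`i < j` means `i ≤ k`, and the sign is `(-1)^(n-i)`. -/
def dt (L : PeriodPair) (A : VertexAlgebra V) (n : ℕ) : Ct L V (n + 1) →ₗ[ℂ] Ct L V n :=
  ∑ i : Fin (n + 1), ∑ k : Fin (n + 1) with i ≤ k, (-1 : ℤ) ^ (n - i : ℕ) • resMap L A i k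

/-- The translation operator `T_i` on the `i`-th tensor factor. -/
def transAt (A : VertexAlgebra V) {n : ℕ} (i : Fin n) :
    (⨂[ℂ] _ : Fin (n + 1), V) →ₗ[ℂ] (⨂[ℂ] _ : Fin (n + 1), V) :=
  PiTensorProduct.map (Function.update (fun _ => LinearMap.id) i.castSucc A.trans)

/-- The subspace `∑_{i = 1}^n (∂_i + T_i) \tilde C_n`. -/
def rel (L : PeriodPair) (A : VertexAlgebra V) (n : ℕ) : Submodule ℂ (Ct L V n) :=
  ⨆ i : Fin n, LinearMap.range
    ((partialD L i).rTensor (⨂[ℂ] _ : Fin (n + 1), V) + (transAt A i).lTensor (Gam L n))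

/-- The space `C_n` of `n`-chains of the ordered chiral complex. -/
abbrev Ch (L : PeriodPair) (A : VertexAlgebra V) (n : ℕ) : Type _ := Ct L V n ⧸ rel L A n

/-- The filtration induced on `V^{⊗ (n+1)}` by a filtration of `V`. -/
def filTensor {A : VertexAlgebra V} (G : GoodFiltration A) (n : ℕ) (p : ℤ) :
    Submodule ℂ (⨂[ℂ] _ : Fin (n + 1), V) :=
  Submodule.span ℂ {w | ∃ (q : Fin (n + 1) → ℤ) (v : Fin (n + 1) → V),
    ∑ l, q l ≤ p ∧ (∀ l, v l ∈ G.fil (q l)) ∧ w = PiTensorProduct.tprod ℂ v}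

/-- The subspace `∑_{p' + p'' ≤ p} G_{p'} Γ_n ⊗ G_{p''} V^{⊗ (n+1)}` of `\tilde C_n`. -/
def filCt (L : PeriodPair) {A : VertexAlgebra V} (G : GoodFiltration A) (n : ℕ) (p : ℤ) :
    Submodule ℂ (Ct L V n) :=
  ⨆ (p' : ℤ) (p'' : ℤ) (_ : p' + p'' ≤ p),
    Submodule.map₂ (TensorProduct.mk ℂ _ _) (filGam L n p') (filTensor G n p'')

/-- The Hodge filtration `G_p C_n`, the image of `filCt`. -/
def filCh (L : PeriodPair) {A : VertexAlgebra V} (G : GoodFiltration A) (n : ℕ) (p : ℤ) :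
    Submodule ℂ (Ch L A n) :=
  (filCt L G n p).map (rel L A n).mkQ

end Complex

end

end ChiralHodge

/-!
The differential is a signed sum of the residue maps `resMap L A i k`, which send `f ⊗ a¹ ⊗ ⋯` to
`∑ m, f^(m) ⊗ (⋯ ⊗ a^i_(m) a^j ⊗ ⋯)`, where `f^(m)` is the coefficient of `(x_i - x_j)^m` in `f`.
Both assertions hold for each residue map separately, and already before passing to the quotient.

*Descent to the quotient.* Write `D_a = ∂_a + T_a`. Since `(∂_i f)^(m) = (m + 1) f^(m+1)`
(`coeff_partialD_self`) and `(T a)_(m) = -m a_(m-1)` (`VertexAlgebra.trans_mul_left`), the residue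
map kills the image of `D_i` (`resMap_totalTrans_self`). If `a ≠ i`, it intertwines `D_a` with the
operator `D` of the corresponding remaining variable (`totalTrans_resMap`). For `a = j` the
expansion is taken at `x_i = x_j`, so that differentiating a coefficient in `x_j` means applying
`∂_i + ∂_j` to `f` (`partialD_coeff`), while `T (a_(m) b) = (T a)_(m) b + a_(m) T b` because `T` is
a derivation (`transAt_merge`); the resulting extra term is the image of `D_i`, which is killed.

*Stability of the filtration.* Locally `f ∈ G_q Γ_{n+1}` is a sum of functions with poles along at
most `q + n + 1` divisors. If `m ≥ 0`, then `f^(m)` has poles along the restrictions of at most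
as many divisors, that is, it lies in `G_{q+1} Γ_n`; this is compensated by
`a_(m) b ∈ G_{p+p'-1} V` for `a ∈ G_p V` and `b ∈ G_{p'} V`. If `m < 0`, only those summands
contribute which have a pole along `{x_i = x_j}`; this divisor is lost, so `f^(m) ∈ G_q Γ_n`
(`coeff_mem_filGam`), and `a_(m) b ∈ G_{p+p'} V`. In both cases the total weight does not increase
(`filCt_le_comap_resMap`).
-/

namespace ChiralHodge

open scoped TensorProduct

/-! ### Laurent coefficients of meromorphic functions -/

lemma exists_eq_div_pow_of_meromorphicAt {F : ℂ → ℂ} (hF : MeromorphicAt F 0) :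
    ∃ (G : ℂ → ℂ) (N : ℕ), AnalyticAt ℂ G 0 ∧ ∀ᶠ t in 𝓝[≠] 0, F t = G t / t ^ N := by
  obtain ⟨N, hN⟩ := hF
  refine ⟨_, N, hN, ?_⟩
  filter_upwards [self_mem_nhdsWithin] with t ht
  have ht : t ≠ 0 := ht
  simp [ht]

lemma meromorphicAt_of_eq_div_pow {F G : ℂ → ℂ} {N : ℕ} (hG : AnalyticAt ℂ G 0)
    (h : ∀ᶠ t in 𝓝[≠] 0, F t = G t / t ^ N) : MeromorphicAt F 0 :=
  (hG.meromorphicAt.div (analyticAt_id.pow N).meromorphicAt).congr (h.mono fun _ ht => ht.symm)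

lemma laurentCoeff_congr {F F' : ℂ → ℂ} (hF : MeromorphicAt F 0) (h : F' =ᶠ[𝓝[≠] 0] F) (m : ℤ) :
    laurentCoeff F' m = laurentCoeff F m := by
  obtain ⟨G, N, hG, hN⟩ := exists_eq_div_pow_of_meromorphicAt hF
  rw [laurentCoeff_eq hG hN, laurentCoeff_eq hG (by filter_upwards [h, hN] with t h1 h2; rw [h1, h2])]

lemma laurentCoeff_add {F F' : ℂ → ℂ} (hF : MeromorphicAt F 0) (hF' : MeromorphicAt F' 0) (m : ℤ) :
    laurentCoeff (fun t => F t + F' t) m = laurentCoeff F m + laurentCoeff F' m := by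
  obtain ⟨G, N, hG, hN⟩ := exists_eq_div_pow_of_meromorphicAt hF
  obtain ⟨G', N', hG', hN'⟩ := exists_eq_div_pow_of_meromorphicAt hF'
  have h1 : AnalyticAt ℂ (fun t => G t * t ^ N') 0 := hG.mul (analyticAt_id.pow N')
  have h1' : AnalyticAt ℂ (fun t => G' t * t ^ N) 0 := hG'.mul (analyticAt_id.pow N)
  have h2 : ∀ᶠ t in 𝓝[≠] 0, F t = (fun t => G t * t ^ N') t / t ^ (N + N') := by
    filter_upwards [hN, self_mem_nhdsWithin] with t ht ht0
    have ht0 : t ≠ 0 := ht0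
    rw [ht, pow_add]; field_simp
  have h2' : ∀ᶠ t in 𝓝[≠] 0, F' t = (fun t => G' t * t ^ N) t / t ^ (N + N') := by
    filter_upwards [hN', self_mem_nhdsWithin] with t ht ht0
    have ht0 : t ≠ 0 := ht0
    rw [ht, pow_add]; field_simp
  rw [laurentCoeff_eq h1 h2, laurentCoeff_eq h1' h2', laurentCoeff_eq (h1.add h1')
    (N := N + N') (by filter_upwards [h2, h2'] with t h h'; rw [h, h', Pi.add_apply, add_div])]
  split_ifs
  · rw [iteratedDeriv_add h1.contDiffAt h1'.contDiffAt, add_div]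
  · simp

lemma laurentCoeff_const_mul {F : ℂ → ℂ} (hF : MeromorphicAt F 0) (c : ℂ) (m : ℤ) :
    laurentCoeff (fun t => c * F t) m = c * laurentCoeff F m := by
  obtain ⟨G, N, hG, hN⟩ := exists_eq_div_pow_of_meromorphicAt hF
  rw [laurentCoeff_eq hG hN, laurentCoeff_eq (hG.const_smul (c := c)) (N := N)
    (by filter_upwards [hN] with t h; rw [h, Pi.smul_apply, smul_eq_mul, mul_div_assoc])]
  split_ifs
  · rw [iteratedDeriv_const_smul_field]; simp [mul_div_assoc]
  · simp

lemma iteratedDeriv_id_mul_deriv {G : ℂ → ℂ} {z : ℂ} (hG : AnalyticAt ℂ G z) (M : ℕ) :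
    iteratedDeriv M (fun t => t * deriv G t) z =
      z * iteratedDeriv (M + 1) G z + M * iteratedDeriv M G z := by
  induction M generalizing z with
  | zero => simp [iteratedDeriv_one]
  | succ M ih =>
    have hev : iteratedDeriv M (fun t => t * deriv G t) =ᶠ[𝓝 z] fun t =>
        t * iteratedDeriv (M + 1) G t + M * iteratedDeriv M G t :=
      hG.eventually_analyticAt.mono fun t ht => ih ht
    have hd : ∀ k, HasDerivAt (iteratedDeriv k G) (iteratedDeriv (k + 1) G z) z := fun k => by
      rw [iteratedDeriv_succ]
      have hk : AnalyticAt ℂ (iteratedDeriv k G) z := by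
        simpa only [iteratedDeriv_eq_iterate] using hG.iterated_deriv k
      exact hk.differentiableAt.hasDerivAt
    rw [iteratedDeriv_succ, hev.deriv_eq,
      (((hasDerivAt_id' z).fun_mul (hd (M + 1))).fun_add ((hd M).const_mul (M : ℂ))).deriv]
    simp only [Nat.cast_add, Nat.cast_one]
    ring

/-- Differentiation shifts Laurent coefficients; the exponent `-1` produces the value `0`. -/
lemma laurentCoeff_deriv {F : ℂ → ℂ} (hF : MeromorphicAt F 0) (m : ℤ) :
    laurentCoeff (deriv F) m = (m + 1) * laurentCoeff F (m + 1) := by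
  obtain ⟨G, N, hG, hN⟩ := exists_eq_div_pow_of_meromorphicAt hF
  have hG' : AnalyticAt ℂ (fun t => t * deriv G t - N * G t) 0 :=
    (analyticAt_id.mul hG.deriv).sub (analyticAt_const.mul hG)
  have h : ∀ᶠ t in 𝓝[≠] 0, deriv F t = (fun t => t * deriv G t - N * G t) t / t ^ (N + 1) := by
    filter_upwards [eventually_eventually_nhdsWithin.2 hN, self_mem_nhdsWithin,
      eventually_nhdsWithin_of_eventually_nhds hG.eventually_analyticAt] with t ht ht0 hGt
    have ht0 : t ≠ 0 := ht0
    rw [isOpen_compl_singleton.nhdsWithin_eq ht0] at ht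
    rw [EventuallyEq.deriv_eq ht, (hGt.differentiableAt.hasDerivAt.fun_div (hasDerivAt_pow N t)
      (pow_ne_zero _ ht0)).deriv]
    rcases N with _ | N
    · simp; field_simp
    · simp only [Nat.add_sub_cancel]
      field_simp
      ring
  rw [laurentCoeff_eq hG' h, laurentCoeff_eq hG hN]
  have he : m + (N + 1 : ℕ) = m + 1 + N := by push_cast; ring
  rw [he]
  split_ifs with hm
  · obtain ⟨M, hM⟩ := Int.eq_ofNat_of_zero_le hm
    have hMc : (m : ℂ) + 1 = M - N := by
      have : m + 1 = M - N := by omega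
      exact_mod_cast congrArg (Int.cast : ℤ → ℂ) this
    have hs : AnalyticAt ℂ (fun t => t * deriv G t) 0 := analyticAt_id.mul hG.deriv
    have hs' : AnalyticAt ℂ (fun t => (N : ℂ) * G t) 0 := analyticAt_const.mul hG
    rw [hM, Int.toNat_natCast, hMc, iteratedDeriv_fun_sub hs.contDiffAt hs'.contDiffAt,
      iteratedDeriv_id_mul_deriv hG, iteratedDeriv_const_mul_field]
    ring
  · simp

/-! ### Derivations and Laurent coefficients of functions on configuration spaces -/

/-- Derivatives in the `ℂ`-direction commute with the derivative along `u`: near the given point,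
`K` is the `M`-th derivative of `H` in the last variable. -/
lemma iteratedDeriv_fderiv_comm {E : Type*} [NormedAddCommGroup E] [NormedSpace ℂ E]
    {x₀ : E} {H : E × ℂ → ℂ} (hH : AnalyticAt ℂ H (x₀, 0)) (u : E) (M : ℕ) :
    ∃ K : E × ℂ → ℂ, AnalyticAt ℂ K (x₀, 0) ∧
      (∀ᶠ z in 𝓝 (x₀, (0 : ℂ)), iteratedDeriv M (fun t => H (z.1, t)) z.2 = K z) ∧
      ∀ᶠ z in 𝓝 (x₀, (0 : ℂ)),
        iteratedDeriv M (fun t => fderiv ℂ H (z.1, t) (u, 0)) z.2 = fderiv ℂ K z (u, 0) := by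
  have hda : ∀ (k : E × ℂ → ℂ) z v, AnalyticAt ℂ k z →
      HasFDerivAt (fun x => fderiv ℂ k x v) ((fderiv ℂ (fderiv ℂ k) z).flip v) z := by
    intro k z v hk
    have := hk.fderiv.differentiableAt.hasFDerivAt.clm_apply (hasFDerivAt_const v z)
    refine this.congr_fderiv ?_
    ext w
    · simp
    · simp
  have hline : ∀ (k : E × ℂ → ℂ) z, DifferentiableAt ℂ k z →
      HasDerivAt (fun s => k (z.1, s)) (fderiv ℂ k z (0, 1)) z.2 := by
    intro k z hk
    have h1 : HasDerivAt (fun s : ℂ => (z.1, s)) ((0 : E), (1 : ℂ)) z.2 :=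
      (hasDerivAt_const z.2 z.1).prodMk (hasDerivAt_id z.2)
    exact hk.hasFDerivAt.comp_hasDerivAt_of_eq z.2 h1 rfl
  have hct : ∀ z : E × ℂ, ContinuousAt (fun s : ℂ => (z.1, s)) z.2 := fun z => by fun_prop
  induction M with
  | zero => exact ⟨H, hH, by simp, by simp⟩
  | succ M ih =>
    obtain ⟨K, hK, h1, h2⟩ := ih
    refine ⟨fun z => fderiv ℂ K z (0, 1), ?_, ?_, ?_⟩
    · exact ((ContinuousLinearMap.apply ℂ ℂ ((0, 1) : E × ℂ)).analyticAt _).comp hK.fderiv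
    · filter_upwards [h1.eventually_nhds, hK.eventually_analyticAt] with z hz hKz
      have hev : iteratedDeriv M (fun t => H (z.1, t)) =ᶠ[𝓝 z.2] fun s => K (z.1, s) :=
        (hct z).eventually hz
      rw [iteratedDeriv_succ, hev.deriv_eq, (hline K z hKz.differentiableAt).deriv]
    · filter_upwards [h2.eventually_nhds, hK.eventually_analyticAt] with z hz hKz
      have hev : iteratedDeriv M (fun t => fderiv ℂ H (z.1, t) (u, 0)) =ᶠ[𝓝 z.2]
          fun s => fderiv ℂ K (z.1, s) (u, 0) := (hct z).eventually hz
      have hsymm : IsSymmSndFDerivAt ℂ K z :=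
        (hKz.contDiffAt (n := 2)).isSymmSndFDerivAt (by simp)
      rw [iteratedDeriv_succ, hev.deriv_eq,
        (hline (fun z => fderiv ℂ K z (u, 0)) z (hda K z _ hKz).differentiableAt).deriv,
        (hda K z _ hKz).fderiv, (hda K z _ hKz).fderiv]
      exact hsymm _ _

/-- Near `(x, 0)` the only divisor is `{t = 0}`, and the singularity of `f` along it is the same
power of `t` for all nearby `x`. -/
lemma exists_local_form {L : PeriodPair} {n : ℕ} (i k : Fin (n + 1))
    {f : (Fin (n + 1) → ℂ) → ℂ} (hf : f ∈ regFun L (n + 1)) {x : Fin n → ℂ} (hx : x ∈ conf L n) :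
    ∃ (H : (Fin n → ℂ) × ℂ → ℂ) (B : ℕ), AnalyticAt ℂ H (x, 0) ∧
      ∀ᶠ z in 𝓝 (x, (0 : ℂ)), z.2 ≠ 0 → ins i k z.1 z.2 ∈ conf L (n + 1) →
        f (ins i k z.1 z.2) = H z / z.2 ^ B := by
  obtain ⟨-, -, N, hN⟩ := hf
  obtain ⟨g, R, hg, hR, h, hR0, -⟩ := (hN (ins i k x 0)).ins_form i k
  exact ⟨fun z => g z / R z, _, hg.div hR (hR0 x hx), h⟩

lemma ins_eq {n : ℕ} (i k : Fin (n + 1)) (x : Fin n → ℂ) (t : ℂ) (a : Fin (n + 1)) :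
    ins i k x t a = pts x (mrg i k a.castSucc) + t * (if a = i then 1 else 0) := by
  rw [← pts_castSucc (ins i k x t), pts_ins]
  simp

lemma ins_add {n : ℕ} (i k : Fin (n + 1)) (x y : Fin n → ℂ) (t s : ℂ) :
    ins i k (x + y) (t + s) = ins i k x t + ins i k y s := by
  funext a
  simp only [Pi.add_apply, ins_eq, pts_add]
  ring

lemma ins_smul {n : ℕ} (i k : Fin (n + 1)) (x : Fin n → ℂ) (t c : ℂ) :
    ins i k (c • x) (c • t) = c • ins i k x t := by
  have hp : ∀ b, pts (c • x) b = c * pts x b := fun b => by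
    induction b using Fin.lastCases <;> simp
  funext a
  simp only [Pi.smul_apply, ins_eq, hp, smul_eq_mul]
  ring

/-- The insertion map `(x, t) ↦ ins i k x t` as a linear map. -/
noncomputable def insL {n : ℕ} (i k : Fin (n + 1)) : (Fin n → ℂ) × ℂ →L[ℂ] (Fin (n + 1) → ℂ) :=
  LinearMap.toContinuousLinearMap
    { toFun := fun z => ins i k z.1 z.2
      map_add' := fun z w => ins_add i k z.1 w.1 z.2 w.2
      map_smul' := fun c z => ins_smul i k z.1 z.2 c }

@[simp] lemma insL_apply {n : ℕ} (i k : Fin (n + 1)) (z : (Fin n → ℂ) × ℂ) :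
    insL i k z = ins i k z.1 z.2 := rfl

lemma ins_zero_one {n : ℕ} (i k : Fin (n + 1)) : ins i k (0 : Fin n → ℂ) 1 = Pi.single i 1 := by
  have hp : ∀ b, pts (0 : Fin n → ℂ) b = 0 := fun b => by
    induction b using Fin.lastCases <;> simp
  funext a
  simp [ins_eq, hp, Pi.single_apply]

lemma ins_single_zero {n : ℕ} (i k : Fin (n + 1)) (l : Fin n) :
    ins i k (Pi.single l 1 : Fin n → ℂ) 0 =
      Pi.single (i.succAbove l) 1 + (if l.castSucc = k then (1 : ℂ) else 0) • Pi.single i 1 := by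
  have hp : pts (Pi.single l 1 : Fin n → ℂ) k = if l.castSucc = k then 1 else 0 := by
    induction k using Fin.lastCases with
    | last => simp [Fin.castSucc_ne_last]
    | cast k => simp [Pi.single_apply, eq_comm]
  funext a
  rcases Fin.eq_self_or_eq_succAbove i a with rfl | ⟨b, rfl⟩
  · rw [Pi.add_apply, Pi.smul_apply]
    simp [ins, hp, Fin.ne_succAbove]
  · rw [Pi.add_apply, Pi.smul_apply]
    simp [ins, Pi.single_apply, Fin.succAbove_ne]

lemma meromorphicAt_ins {L : PeriodPair} {n : ℕ} (i k : Fin (n + 1))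
    {f : (Fin (n + 1) → ℂ) → ℂ} (hf : f ∈ regFun L (n + 1)) {x : Fin n → ℂ} (hx : x ∈ conf L n) :
    MeromorphicAt (fun t => f (ins i k x t)) 0 := by
  obtain ⟨N, hN⟩ := hf.2.2
  obtain ⟨G, hG, h⟩ := exists_laurent i k hN hx
  exact meromorphicAt_of_eq_div_pow hG h

lemma coeffFun_partialFun_self {L : PeriodPair} {n : ℕ} (i k : Fin (n + 1)) (m : ℤ)
    {f : (Fin (n + 1) → ℂ) → ℂ} (hf : f ∈ regFun L (n + 1)) (x : Fin n → ℂ) :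
    coeffFun L i k m (partialFun L i f) x = (m + 1) * coeffFun L i k (m + 1) f x := by
  by_cases hx : x ∈ conf L n
  · rw [coeffFun, coeffFun, if_pos hx, if_pos hx,
      ← laurentCoeff_deriv (meromorphicAt_ins i k hf hx)]
    refine (laurentCoeff_congr (meromorphicAt_ins i k (partialFun_mem i hf) hx) ?_ m).symm
    filter_upwards [eventually_ins_mem_conf i k hx] with t ht
    obtain ⟨N, hN⟩ := hf.2.2
    have h1 : HasDerivAt (fun s : ℂ => ins i k x s) (Pi.single i 1) t := by
      have := (insL i k).hasFDerivAt (x := (x, t)) |>.comp_hasDerivAt_of_eq t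
        ((hasDerivAt_const t x).prodMk (hasDerivAt_id t)) rfl
      simpa [Function.comp_def, ins_zero_one] using this
    rw [partialFun, if_pos ht]
    exact (((hN _).analyticAt ht).differentiableAt.hasFDerivAt.comp_hasDerivAt_of_eq t h1 rfl).deriv
  · simp [coeffFun, hx]

lemma coeff_partialD_self {L : PeriodPair} {n : ℕ} (i k : Fin (n + 1)) (m : ℤ)
    (f : Gam L (n + 1)) :
    coeff L i k m (partialD L i f) = ((m : ℂ) + 1) • coeff L i k (m + 1) f :=
  Subtype.ext (funext fun x => coeffFun_partialFun_self i k m f.2 x)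

/-- When `x_i` is expanded around `x_k`, moving the remaining variable `x_l` also moves `x_i` if
`l = k`. If `k` is the last index, the expansion is at `x_i = 0` and there is no second term. -/
lemma partialD_coeff {L : PeriodPair} {n : ℕ} (i k : Fin (n + 1)) (l : Fin n) (m : ℤ)
    (f : Gam L (n + 1)) :
    partialD L l (coeff L i k m f) = coeff L i k m (partialD L (i.succAbove l) f) +
      (if l.castSucc = k then (1 : ℂ) else 0) • coeff L i k m (partialD L i f) := by
  set c : ℂ := if l.castSucc = k then (1 : ℂ) else 0 with hc
  rw [← map_smul, ← map_add]
  refine Subtype.ext (funext fun x => ?_)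
  change partialFun L l (coeffFun L i k m f.1) x = coeffFun L i k m
    (partialFun L (i.succAbove l) f.1 + c • partialFun L i f.1) x
  by_cases hx : x ∈ conf L n
  swap
  · simp [coeffFun, partialFun, hx]
  obtain ⟨H, B, hH, h⟩ := exists_local_form i k f.2 hx
  obtain ⟨N, hN⟩ := f.2.2.2
  have hct : ∀ y : Fin n → ℂ, ContinuousAt (fun s : ℂ => (y, s)) 0 := fun y => by fun_prop
  have hct' : ContinuousAt (fun y : Fin n → ℂ => (y, (0 : ℂ))) x := by fun_prop
  have hslice : ∀ y : Fin n → ℂ, AnalyticAt ℂ (fun s : ℂ => (y, s)) 0 := fun y =>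
    analyticAt_const.prod analyticAt_id
  let e : (Fin n → ℂ) × ℂ := (Pi.single l 1, 0)
  have hDH : AnalyticAt ℂ (fun z => fderiv ℂ H z e) (x, 0) :=
    ((ContinuousLinearMap.apply ℂ ℂ e).analyticAt _).comp hH.fderiv
  -- the derivative of the local expression in the direction of `x_l`
  have hder : ∀ᶠ t in 𝓝[≠] (0 : ℂ),
      (partialFun L (i.succAbove l) f.1 + c • partialFun L i f.1) (ins i k x t) =
        fderiv ℂ H (x, t) e / t ^ B := by
    filter_upwards [eventually_ins_mem_conf i k hx, self_mem_nhdsWithin,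
      eventually_nhdsWithin_of_eventually_nhds ((hct x).eventually h.eventually_nhds),
      eventually_nhdsWithin_of_eventually_nhds ((hct x).eventually hH.eventually_analyticAt)]
      with t ht ht0 hev hHt
    have ht0 : t ≠ 0 := ht0
    have hfa := ((hN _).analyticAt ht).differentiableAt.hasFDerivAt
    have hL : HasDerivAt (fun s : ℂ => f.1 (ins i k (x + s • Pi.single l 1) t))
        (fderiv ℂ f.1 (ins i k x t) (ins i k (Pi.single l 1) 0)) 0 := by
      have h1 : HasDerivAt (fun s : ℂ => ins i k (x + s • Pi.single l 1) t)
          (ins i k (Pi.single l 1) 0) 0 := by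
        have h2 : (fun s : ℂ => ins i k (x + s • Pi.single l 1) t) =
            fun s => ins i k x t + s • ins i k (Pi.single l 1) 0 := by
          funext s
          rw [← ins_smul, ← ins_add, smul_zero, add_zero]
        rw [h2]
        simpa using ((hasDerivAt_id (0 : ℂ)).smul_const
          (ins i k (Pi.single l 1 : Fin n → ℂ) 0)).const_add (ins i k x t)
      exact hfa.comp_hasDerivAt_of_eq 0 h1 (by simp)
    have hR : HasDerivAt (fun s : ℂ => H (x + s • Pi.single l 1, t) / t ^ B)
        (fderiv ℂ H (x, t) e / t ^ B) 0 := by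
      have h1 : HasDerivAt (fun s : ℂ => (x + s • (Pi.single l 1 : Fin n → ℂ), t)) e 0 := by
        refine HasDerivAt.prodMk ?_ (hasDerivAt_const _ _)
        simpa using ((hasDerivAt_id (0 : ℂ)).smul_const (Pi.single l 1 : Fin n → ℂ)).const_add x
      exact (hHt.differentiableAt.hasFDerivAt.comp_hasDerivAt_of_eq 0 h1 (by simp)).div_const _
    have hLR : (fun s : ℂ => f.1 (ins i k (x + s • Pi.single l 1) t)) =ᶠ[𝓝 0]
        fun s : ℂ => H (x + s • Pi.single l 1, t) / t ^ B := by
      have hc1 : ContinuousAt (fun s : ℂ => (x + s • (Pi.single l 1 : Fin n → ℂ), t)) 0 := by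
        fun_prop
      have hc2 : ContinuousAt (fun s : ℂ => insL i k (x + s • Pi.single l 1, t)) 0 := by
        fun_prop
      filter_upwards [hc1.eventually (by simpa using hev),
        hc2.eventually_mem ((isOpen_conf L (n + 1)).mem_nhds (by simpa using ht))] with s hs hs'
      exact hs ht0 hs'
    have := (hL.congr_of_eventuallyEq hLR.symm).unique hR
    rw [← this, ins_single_zero, map_add, map_smul]
    rw [Pi.add_apply, Pi.smul_apply, partialFun, partialFun, if_pos ht, if_pos ht]
  rw [partialFun, if_pos hx, coeffFun, if_pos hx,
    laurentCoeff_eq (G := fun t => fderiv ℂ H (x, t) e) (hDH.fun_comp (hslice x)) hder]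
  -- near `x` the coefficient is a Taylor coefficient of one analytic function `H`
  have hval : coeffFun L i k m f.1 =ᶠ[𝓝 x] fun y => if 0 ≤ m + B then
      iteratedDeriv (m + B).toNat (fun t => H (y, t)) 0 / ((m + B).toNat.factorial : ℂ) else 0 := by
    filter_upwards [(isOpen_conf L n).mem_nhds hx, hct'.eventually h.eventually_nhds,
      hct'.eventually hH.eventually_analyticAt] with y hy hy1 hy2
    rw [coeffFun, if_pos hy]
    refine laurentCoeff_eq (hy2.fun_comp (hslice y)) ?_ m
    filter_upwards [eventually_ins_mem_conf i k hy, self_mem_nhdsWithin,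
      eventually_nhdsWithin_of_eventually_nhds ((hct y).eventually hy1)] with t h1 h2 h3
    exact h3 h2 h1
  rw [hval.fderiv_eq]
  split_ifs with hm
  · obtain ⟨K, hK, hK1, hK2⟩ := iteratedDeriv_fderiv_comm hH (Pi.single l 1 : Fin n → ℂ)
      (m + B).toNat
    have hev : (fun y => iteratedDeriv (m + B).toNat (fun t => H (y, t)) 0 /
        ((m + B).toNat.factorial : ℂ)) =ᶠ[𝓝 x] fun y => K (y, 0) /
        ((m + B).toNat.factorial : ℂ) := by
      filter_upwards [hct'.eventually hK1] with y hy
      rw [← hy]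
    rw [hev.fderiv_eq, hK2.self_of_nhds]
    have h1 : HasFDerivAt (fun y : Fin n → ℂ => (y, (0 : ℂ)))
        (ContinuousLinearMap.inl ℂ (Fin n → ℂ) ℂ) x := hasFDerivAt_prodMk_left x 0
    have h2 := hK.differentiableAt.hasFDerivAt.comp x h1
    simp only [div_eq_mul_inv]
    have h3 := (h2.mul_const (((m + B).toNat.factorial : ℂ)⁻¹)).fderiv
    simp only [Function.comp_def] at h3
    rw [h3]
    simp [mul_comm]
  · simp

/-! ### Translation in a vertex algebra -/

namespace VertexAlgebra

variable {V : Type*} [AddCommGroup V] [Module ℂ V]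

lemma choose_neg_two (j : ℕ) : Ring.choose (-2 : ℤ) j = (-1) ^ j * (j + 1) := by
  rw [Ring.choose_neg, show (2 : ℤ) + j - 1 = ((j + 1 : ℕ) : ℤ) by push_cast; ring,
    Ring.choose_natCast, Nat.choose_succ_self_right]
  simp [Units.smul_def, Int.negOnePow_def, mul_add]

/-- The Borcherds identity with `m = 0`. -/
lemma mul_mul (A : VertexAlgebra V) (a b c : V) (n k : ℤ) :
    A.mul k (A.mul n a b) c = ∑ᶠ j : ℕ, ((-1 : ℤ) ^ j * Ring.choose n j) •
      (A.mul (n - j) a (A.mul (k + j) b c)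
        - (n.negOnePow : ℤ) • A.mul (n + k - j) b (A.mul j a c)) := by
  have h := A.borcherds a b c 0 n k
  rw [finsum_eq_single _ 0 (fun j hj => by
    obtain ⟨j, rfl⟩ := Nat.exists_eq_succ_of_ne_zero hj
    simp [Ring.choose_zero_succ])] at h
  simpa using h

lemma trans_mul_left (A : VertexAlgebra V) (a c : V) (k : ℤ) :
    A.mul k (A.trans a) c = -(k : ℂ) • A.mul (k - 1) a c := by
  have hk : ∀ r : ℤ, r • A.mul (k - 1) a c = (r : ℂ) • A.mul (k - 1) a c := fun r =>
    (Int.cast_smul_eq_zsmul ℂ r _).symm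
  rw [trans, LinearMap.flip_apply, mul_mul]
  simp only [A.vac_mul, choose_neg_two, ← mul_assoc, ← mul_pow]
  rcases lt_trichotomy k 0 with h | rfl | h
  · obtain ⟨j, hj⟩ := Int.eq_ofNat_of_zero_le (show 0 ≤ -1 - k by omega)
    rw [finsum_eq_single _ j]
    · rw [if_pos (by omega), if_neg (by omega), show (-2 : ℤ) - j = k - 1 by omega]
      simp only [smul_zero, sub_zero, hk]
      congr 1
      have : (j : ℤ) + 1 = -k := by omega
      simp [this]
    · intro l hl
      rw [if_neg (by omega), if_neg (by omega)]
      simp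
  · refine (finsum_eq_zero_of_forall_eq_zero fun j => ?_).trans (by simp)
    rw [if_neg (by omega), if_neg (by omega)]
    simp
  · obtain ⟨j, hj⟩ := Int.eq_ofNat_of_zero_le (show 0 ≤ k - 1 by omega)
    rw [finsum_eq_single _ j]
    · rw [if_neg (by omega), if_pos (by omega), show (j : ℤ) = k - 1 by omega]
      simp [Int.negOnePow_def, hk]
    · intro l hl
      rw [if_neg (by omega), if_neg (by omega)]
      simp

/-- `T` is a derivation of every product. -/
lemma trans_mul (A : VertexAlgebra V) (a b : V) (n : ℤ) :
    A.trans (A.mul n a b) = A.mul n (A.trans a) b + A.mul n a (A.trans b) := by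
  rw [trans_mul_left, trans, LinearMap.flip_apply, mul_mul, LinearMap.flip_apply]
  rw [finsum_eq_sum_of_support_subset (s := {0, 1})]
  · rw [Finset.sum_pair (by norm_num)]
    simp [A.mul_vac_nonneg, A.mul_vac, Int.cast_smul_eq_zsmul, add_comm]
  · intro j hj
    by_contra h
    simp at h
    refine hj ?_
    simp only
    rw [A.mul_vac_nonneg a j (by omega), A.mul_vac_nonneg b _ (by omega)]
    simp

end VertexAlgebra

/-! ### Translation and merging of tensor factors -/

section Merge

variable {V : Type*} [AddCommGroup V] [Module ℂ V]

lemma merge_tprod (A : VertexAlgebra V) {n : ℕ} (i k : Fin (n + 1)) (m : ℤ) (v : Fin (n + 2) → V) :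
    merge A i k m (PiTensorProduct.tprod ℂ v) = PiTensorProduct.tprod ℂ
      (Function.update (fun l => v (i.castSucc.succAbove l)) k
        (A.mul m (v i.castSucc) (v (i.castSucc.succAbove k)))) := by
  rw [merge, PiTensorProduct.lift.tprod]
  rfl

lemma transAt_tprod (A : VertexAlgebra V) {n : ℕ} (i : Fin n) (v : Fin (n + 1) → V) :
    transAt A i (PiTensorProduct.tprod ℂ v) = PiTensorProduct.tprod ℂ
      (Function.update v i.castSucc (A.trans (v i.castSucc))) := by
  rw [transAt, PiTensorProduct.map_tprod]
  congr 1
  funext l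
  by_cases h : l = i.castSucc
  · subst h; simp
  · simp [h]

/-- The identity `(T a)_(m) = -m a_(m-1)` applied to the factor that is merged. -/
lemma merge_transAt_self (A : VertexAlgebra V) {n : ℕ} (i k : Fin (n + 1)) (m : ℤ)
    (w : ⨂[ℂ] _ : Fin (n + 2), V) :
    merge A i k m (transAt A i w) = -(m : ℂ) • merge A i k (m - 1) w := by
  induction w using PiTensorProduct.induction_on with
  | smul_tprod r v =>
    rw [map_smul, map_smul, map_smul, smul_comm]
    congr 1
    rw [transAt_tprod, merge_tprod, merge_tprod, ← MultilinearMap.map_update_smul,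
      ← A.trans_mul_left]
    simp [Fin.succAbove_ne]
  | add x y hx hy => simp only [map_add, hx, hy, smul_add]

/-- `T` is a derivation of the product `a^i_(m) a^j`, so translating the merged factor translates
both of its constituents. -/
lemma transAt_merge (A : VertexAlgebra V) {n : ℕ} (i k : Fin (n + 1)) (l : Fin n) (m : ℤ)
    (w : ⨂[ℂ] _ : Fin (n + 2), V) :
    transAt A l (merge A i k m w) = merge A i k m (transAt A (i.succAbove l) w) +
      (if l.castSucc = k then (1 : ℂ) else 0) • merge A i k m (transAt A i w) := by
  induction w using PiTensorProduct.induction_on with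
  | smul_tprod r v =>
    simp only [map_smul]
    rw [smul_comm _ r, ← smul_add]
    congr 1
    have hup : ∀ z, (fun l' => Function.update v (i.castSucc.succAbove l.castSucc) z
        (i.castSucc.succAbove l')) =
        Function.update (fun l' => v (i.castSucc.succAbove l')) l.castSucc z := fun z =>
      Function.update_comp_eq_of_injective v Fin.succAbove_right_injective l.castSucc z
    have htr : transAt A (i.succAbove l) (PiTensorProduct.tprod ℂ v) = PiTensorProduct.tprod ℂ
        (Function.update v (i.castSucc.succAbove l.castSucc)
          (A.trans (v (i.castSucc.succAbove l.castSucc)))) := by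
      rw [Fin.castSucc_succAbove_castSucc]
      exact transAt_tprod A _ v
    simp only [htr, transAt_tprod, merge_tprod, hup]
    rw [Function.update_of_ne (Fin.succAbove_ne _ _).symm]
    split_ifs with h
    · subst h
      simp only [Function.update_self, Function.update_idem, one_smul]
      rw [A.trans_mul, MultilinearMap.map_update_add]
      refine (add_comm _ _).trans ?_
      simp [Fin.succAbove_ne, -Fin.castSucc_succAbove_castSucc]
    · have hne : i.castSucc.succAbove k ≠ i.castSucc.succAbove l.castSucc := by
        exact fun h' => h (Fin.succAbove_right_injective h').symm
      rw [Function.update_of_ne h, Function.update_of_ne hne, Function.update_comm h, zero_smul,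
        add_zero]
  | add x y hx hy => simp only [map_add, hx, hy, smul_add]; abel

end Merge

/-! ### The differential on chains -/

section Differential

variable {V : Type*} [AddCommGroup V] [Module ℂ V]

/-- The operator `∂_i + T_i` on `\tilde C_n`. -/
noncomputable def totalTrans (L : PeriodPair) (A : VertexAlgebra V) {n : ℕ} (i : Fin n) :
    Ct L V n →ₗ[ℂ] Ct L V n :=
  (partialD L i).rTensor (⨂[ℂ] _ : Fin (n + 1), V) + (transAt A i).lTensor (Gam L n)

lemma totalTrans_tmul (L : PeriodPair) (A : VertexAlgebra V) {n : ℕ} (i : Fin n) (f : Gam L n)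
    (w : ⨂[ℂ] _ : Fin (n + 1), V) :
    totalTrans L A i (f ⊗ₜ w) = partialD L i f ⊗ₜ w + f ⊗ₜ transAt A i w := by
  simp [totalTrans]

lemma resMap_tmul (L : PeriodPair) (A : VertexAlgebra V) {n : ℕ} (i k : Fin (n + 1))
    (f : Gam L (n + 1)) (w : ⨂[ℂ] _ : Fin (n + 2), V) :
    resMap L A i k (f ⊗ₜ w) = ∑ᶠ m : ℤ, coeff L i k m f ⊗ₜ[ℂ] merge A i k m w := by
  simp [resMap]

/-- The residue in `x_i` annihilates total derivatives in `x_i`: the series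
`∑ (m + 1) f^(m+1) ⊗ a_(m) b` and `∑ m f^(m) ⊗ a_(m-1) b` agree after a shift of the index. -/
lemma resMap_totalTrans_self (L : PeriodPair) (A : VertexAlgebra V) {n : ℕ} (i k : Fin (n + 1))
    (ω : Ct L V (n + 1)) : resMap L A i k (totalTrans L A i ω) = 0 := by
  induction ω using TensorProduct.induction_on with
  | zero => simp
  | tmul f w =>
    rw [totalTrans_tmul, map_add, resMap_tmul, resMap_tmul]
    simp only [coeff_partialD_self, merge_transAt_self]
    rw [← finsum_comp_equiv (Equiv.addRight (1 : ℤ))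
      (f := fun m : ℤ => coeff L i k m f ⊗ₜ[ℂ] (-(m : ℂ) • merge A i k (m - 1) w))]
    have : (fun m : ℤ => coeff L i k (Equiv.addRight (1 : ℤ) m) f ⊗ₜ[ℂ]
        (-((Equiv.addRight (1 : ℤ) m : ℤ) : ℂ) • merge A i k (Equiv.addRight (1 : ℤ) m - 1) w)) =
        fun m : ℤ => -((((m : ℂ) + 1) • coeff L i k (m + 1) f) ⊗ₜ[ℂ] merge A i k m w) := by
      funext m
      simp only [Equiv.coe_addRight, add_sub_cancel_right, Int.cast_add, Int.cast_one, neg_smul,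
        TensorProduct.tmul_neg, TensorProduct.tmul_smul, TensorProduct.smul_tmul']
    rw [this, finsum_neg_distrib, add_neg_cancel]
  | add x y hx hy => simp only [map_add, hx, hy, add_zero]

/-- The term by which the two sides differ when `j` is the variable in question is a residue of a
total derivative in `x_i`. -/
lemma totalTrans_resMap (L : PeriodPair) (A : VertexAlgebra V) {n : ℕ} (i k : Fin (n + 1))
    (l : Fin n) (ω : Ct L V (n + 1)) :
    totalTrans L A l (resMap L A i k ω) = resMap L A i k (totalTrans L A (i.succAbove l) ω) := by
  suffices h : totalTrans L A l (resMap L A i k ω) =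
      resMap L A i k (totalTrans L A (i.succAbove l) ω) +
      (if l.castSucc = k then (1 : ℂ) else 0) • resMap L A i k (totalTrans L A i ω) by
    rw [h, resMap_totalTrans_self, smul_zero, add_zero]
  set c : ℂ := if l.castSucc = k then (1 : ℂ) else 0 with hc
  induction ω using TensorProduct.induction_on with
  | zero => simp
  | tmul f w =>
    have hfin := finite_support L A i k
    rw [totalTrans_tmul, totalTrans_tmul, ← map_smul, ← map_add]
    have he : partialD L (i.succAbove l) f ⊗ₜ[ℂ] w + f ⊗ₜ transAt A (i.succAbove l) w +
        c • (partialD L i f ⊗ₜ[ℂ] w + f ⊗ₜ transAt A i w) =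
        (partialD L (i.succAbove l) f + c • partialD L i f) ⊗ₜ[ℂ] w +
        f ⊗ₜ (transAt A (i.succAbove l) w + c • transAt A i w) := by
      simp only [TensorProduct.add_tmul, TensorProduct.tmul_add, smul_add,
        TensorProduct.smul_tmul', TensorProduct.tmul_smul]
      abel
    rw [he, map_add, resMap_tmul, resMap_tmul, resMap_tmul, map_finsum _ (hfin f w),
      ← finsum_add_distrib (hfin _ w) (hfin f _)]
    refine finsum_congr fun m => ?_
    rw [totalTrans_tmul, partialD_coeff, transAt_merge]
    simp only [map_add, map_smul, hc]
  | add x y hx hy => simp only [map_add, hx, hy, smul_add]; abel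

lemma totalTrans_mem_rel (L : PeriodPair) (A : VertexAlgebra V) {n : ℕ} (i : Fin n)
    (ω : Ct L V n) : totalTrans L A i ω ∈ rel L A n :=
  (le_iSup (fun i : Fin n => LinearMap.range (totalTrans L A i)) i) ⟨ω, rfl⟩

lemma rel_le_comap_resMap (L : PeriodPair) (A : VertexAlgebra V) {n : ℕ} (i k : Fin (n + 1)) :
    rel L A (n + 1) ≤ (rel L A n).comap (resMap L A i k) := by
  refine iSup_le fun a => ?_
  rintro _ ⟨ω, rfl⟩
  change resMap L A i k (totalTrans L A a ω) ∈ rel L A n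
  rcases Fin.eq_self_or_eq_succAbove i a with rfl | ⟨l, rfl⟩
  · rw [resMap_totalTrans_self]
    exact zero_mem _
  · rw [← totalTrans_resMap]
    exact totalTrans_mem_rel L A l _

lemma dt_mem (L : PeriodPair) (A : VertexAlgebra V) {n : ℕ} (U : Submodule ℂ (Ct L V n))
    {ω : Ct L V (n + 1)} (h : ∀ i k, resMap L A i k ω ∈ U) : dt L A n ω ∈ U := by
  simp only [dt, LinearMap.sum_apply, LinearMap.smul_apply]
  exact sum_mem fun i _ => sum_mem fun k _ => zsmul_mem (h i k) _

lemma rel_le_comap_dt (L : PeriodPair) (A : VertexAlgebra V) (n : ℕ) :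
    rel L A (n + 1) ≤ (rel L A n).comap (dt L A n) := fun _ hω =>
  Submodule.mem_comap.2 (dt_mem L A _ fun i k => rel_le_comap_resMap L A i k hω)

end Differential

/-! ### Laurent coefficients and the filtration by poles -/

/-- The functions near `P` that `filGam` allows there: sums of functions with poles along at most
`c` of the divisors through `P`. -/
def polarSpan (L : PeriodPair) {n : ℕ} (P : Fin n → ℂ) (c : ℤ) : Submodule ℂ ((Fin n → ℂ) → ℂ) :=
  Submodule.span ℂ {g : (Fin n → ℂ) → ℂ |
    ∃ S ⊆ divAt L P, (S.card : ℤ) ≤ c ∧ ∃ (h : (Fin n → ℂ) → ℂ) (N : ℕ),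
      AnalyticAt ℂ h P ∧ g = fun x => h x / eqn S P x ^ N}

/-- Near `P` and on the configuration space, `f` is a quotient of a holomorphic function by a power
of the product of the equations of the divisors in `S`. -/
def PolarOn (L : PeriodPair) {n : ℕ} (S : Finset (Fin (n + 1) × Fin (n + 1))) (P : Fin n → ℂ)
    (f : (Fin n → ℂ) → ℂ) : Prop :=
  ∃ (h : (Fin n → ℂ) → ℂ) (N : ℕ), AnalyticAt ℂ h P ∧
    ∀ᶠ x in 𝓝 P, x ∈ conf L n → f x = h x / eqn S P x ^ N

namespace PolarOn

variable {L : PeriodPair} {n : ℕ} {S : Finset (Fin (n + 1) × Fin (n + 1))} {P : Fin n → ℂ}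
  {f f' : (Fin n → ℂ) → ℂ}

lemma of_analyticAt (hf : AnalyticAt ℂ f P) : PolarOn L S P f :=
  ⟨f, 0, hf, by simp⟩

lemma mul (hf : PolarOn L S P f) (hf' : PolarOn L S P f') :
    PolarOn L S P fun x => f x * f' x := by
  obtain ⟨h, N, hh, he⟩ := hf
  obtain ⟨h', N', hh', he'⟩ := hf'
  refine ⟨fun x => h x * h' x, N + N', hh.mul hh', ?_⟩
  filter_upwards [he, he'] with x hx hx' hxc
  rw [hx hxc, hx' hxc, pow_add, div_mul_div_comm]

lemma pow (hf : PolarOn L S P f) (m : ℕ) : PolarOn L S P fun x => f x ^ m := by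
  obtain ⟨h, N, hh, he⟩ := hf
  refine ⟨fun x => h x ^ m, N * m, hh.pow m, ?_⟩
  filter_upwards [he] with x hx hxc
  rw [hx hxc, div_pow, pow_mul]

lemma prod {ι : Type*} (s : Finset ι) {F : ι → (Fin n → ℂ) → ℂ}
    (hF : ∀ a ∈ s, PolarOn L S P (F a)) :
    PolarOn L S P fun x => ∏ a ∈ s, F a x := by
  classical
  induction s using Finset.induction_on with
  | empty => simpa using of_analyticAt (L := L) (S := S) (P := P) (f := fun _ => 1) analyticAt_const
  | insert a s ha ih =>
    simp only [Finset.prod_insert ha]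
    exact (hF a (by simp)).mul (ih fun b hb => hF b (by simp [hb]))

lemma inv_lin (hS : S ⊆ divAt L P) {p} (hp : p ∈ S) :
    PolarOn L S P fun x => (lin p (x - P))⁻¹ := by
  classical
  refine ⟨fun x => eqn (S.erase p) P x, 1, analyticAt_eqn _ _ _, Eventually.of_forall fun x hx => ?_⟩
  have h1 := lin_ne_zero hx (hS hp)
  have h2 := eqn_ne_zero hx ((S.erase_subset p).trans hS)
  have h3 : eqn S P x = lin p (x - P) * eqn (S.erase p) P x := (Finset.mul_prod_erase _ _ hp).symm
  rw [pow_one, h3]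
  field_simp

lemma congr (hf : PolarOn L S P f) (h : ∀ᶠ x in 𝓝 P, x ∈ conf L n → f' x = f x) :
    PolarOn L S P f' := by
  obtain ⟨g, N, hg, he⟩ := hf
  refine ⟨g, N, hg, ?_⟩
  filter_upwards [he, h] with x hx hx' hxc
  rw [hx' hxc, hx hxc]

lemma exists_mem_polarSpan (hf : PolarOn L S P f) (hS : S ⊆ divAt L P) {c : ℤ}
    (hc : (S.card : ℤ) ≤ c) : ∃ g ∈ polarSpan L P c, ∀ᶠ x in 𝓝 P, x ∈ conf L n → f x = g x := by
  obtain ⟨h, N, hh, he⟩ := hf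
  exact ⟨_, Submodule.subset_span ⟨S, hS, hc, h, N, hh, rfl⟩, he⟩

end PolarOn

open Classical in
/-- The divisor of `E^n` into which the divisor `{x_{p.1} = x_{p.2}}` of `E^{n+1}` is turned when
the `i`-th variable is merged; the two indices are put into increasing order. -/
noncomputable def mrgDiv {n : ℕ} (i k : Fin (n + 1)) (p : Fin (n + 2) × Fin (n + 2)) :
    Fin (n + 1) × Fin (n + 1) :=
  if mrg i k p.1 < mrg i k p.2 then (mrg i k p.1, mrg i k p.2) else (mrg i k p.2, mrg i k p.1)

/-- Restricting to `{x_i = x_j}` the divisors in `T`, all different from it, gives at most as many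
divisors. -/
lemma polarOn_prod_inv_lin {L : PeriodPair} {n : ℕ} (i k : Fin (n + 1)) {P : Fin n → ℂ}
    {T : Finset (Fin (n + 2) × Fin (n + 2))}
    (hT : ∀ p ∈ T, mrg i k p.1 ≠ mrg i k p.2 ∧ lin (mrg i k p.1, mrg i k p.2) P ∈ L.lattice) :
    ∃ S ⊆ divAt L P, S.card ≤ T.card ∧
      PolarOn L S P fun x => ∏ p ∈ T, (lin (mrg i k p.1, mrg i k p.2) (x - P))⁻¹ := by
  classical
  have hneg : ∀ (a b : Fin (n + 1)) (x : Fin n → ℂ), lin (a, b) x = - lin (b, a) x :=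
    fun a b x => by simp [lin]
  have hS : T.image (mrgDiv i k) ⊆ divAt L P := by
    intro d hd
    obtain ⟨p, hp, rfl⟩ := Finset.mem_image.1 hd
    obtain ⟨h1, h2⟩ := hT p hp
    simp only [divAt, Finset.mem_filter, Finset.mem_univ, true_and, mrgDiv]
    split_ifs with h
    · exact ⟨h, h2⟩
    · refine ⟨lt_of_le_of_ne (not_lt.1 h) h1.symm, ?_⟩
      rw [hneg]
      exact neg_mem h2
  refine ⟨_, hS, Finset.card_image_le, PolarOn.prod T fun p hp => ?_⟩
  have h0 := PolarOn.inv_lin hS (Finset.mem_image_of_mem (mrgDiv i k) hp)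
  by_cases h : mrg i k p.1 < mrg i k p.2
  · simpa only [mrgDiv, if_pos h] using h0
  · have h1 := (PolarOn.of_analyticAt (L := L) (S := T.image (mrgDiv i k)) (P := P)
      (f := fun _ => (-1 : ℂ)) analyticAt_const).mul h0
    refine h1.congr (Eventually.of_forall fun x _ => ?_)
    simp only [mrgDiv, if_neg h]
    rw [hneg, inv_neg, neg_one_mul]

/-- A Laurent coefficient of a function with poles along the divisors in `S` has poles along at most
as many divisors. For a negative exponent only functions with a pole along `{x_i = x_j}` contribute,
and this divisor disappears. -/
lemma laurentCoeff_div_eqn {L : PeriodPair} {n : ℕ} (i k : Fin (n + 1)) {P : Fin n → ℂ}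
    {S : Finset (Fin (n + 2) × Fin (n + 2))} (hS : S ⊆ divAt L (ins i k P 0)) {c : ℤ}
    (hc : (S.card : ℤ) ≤ c) {h : (Fin (n + 1) → ℂ) → ℂ} (hh : AnalyticAt ℂ h (ins i k P 0))
    (N : ℕ) (m : ℤ) :
    (∀ᶠ x in 𝓝 P, x ∈ conf L n →
      MeromorphicAt (fun t => h (ins i k x t) / eqn S (ins i k P 0) (ins i k x t) ^ N) 0) ∧
    ∃ g ∈ polarSpan L P (if 0 ≤ m then c else c - 1), ∀ᶠ x in 𝓝 P, x ∈ conf L n →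
      laurentCoeff (fun t => h (ins i k x t) / eqn S (ins i k P 0) (ins i k x t) ^ N) m = g x := by
  classical
  let e : Fin (n + 2) × Fin (n + 2) → ℂ := fun p =>
    (if p.1 = i.castSucc then 1 else 0 : ℂ) - (if p.2 = i.castSucc then 1 else 0)
  have hlin : ∀ p (z : (Fin n → ℂ) × ℂ), lin p (ins i k z.1 z.2 - ins i k P 0) =
      lin (mrg i k p.1, mrg i k p.2) (z.1 - P) + z.2 * e p := by
    intro p z
    simp only [lin, pts_sub, pts_ins, e]
    ring
  -- `U` consists of the divisor `{x_i = x_j}` if it lies in `S`, and `T` of the other divisors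
  let U := S.filter fun p => mrg i k p.1 = mrg i k p.2
  let T := S.filter fun p => ¬ mrg i k p.1 = mrg i k p.2
  have hUT : U.card + T.card = S.card := Finset.card_filter_add_card_filter_not _
  have hU : ∀ p ∈ U, e p = 1 ∨ e p = -1 := by
    intro p hp
    have hp' := hS (Finset.mem_filter.1 hp).1
    simp only [divAt, Finset.mem_filter, Finset.mem_univ, true_and] at hp'
    exact mrg_eq hp'.1.ne (Finset.mem_filter.1 hp).2
  have hT : ∀ p ∈ T, mrg i k p.1 ≠ mrg i k p.2 ∧
      lin (mrg i k p.1, mrg i k p.2) P ∈ L.lattice := by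
    intro p hp
    have hp' := hS (Finset.mem_filter.1 hp).1
    simp only [divAt, Finset.mem_filter, Finset.mem_univ, true_and] at hp'
    refine ⟨(Finset.mem_filter.1 hp).2, ?_⟩
    simpa [lin, pts_ins] using hp'.2
  set a : ℂ := ∏ p ∈ U, e p with ha
  have ha0 : a ≠ 0 := Finset.prod_ne_zero_iff.2 fun p hp => by
    rcases hU p hp with h | h <;> rw [h] <;> norm_num
  -- the denominator is `R (x, t)` times a power of `t`
  let R : (Fin n → ℂ) × ℂ → ℂ := fun z =>
    (a * ∏ p ∈ T, lin p (ins i k z.1 z.2 - ins i k P 0)) ^ N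
  let H : (Fin n → ℂ) × ℂ → ℂ := fun z => h (ins i k z.1 z.2)
  have heq : ∀ (x : Fin n → ℂ) t, h (ins i k x t) / eqn S (ins i k P 0) (ins i k x t) ^ N =
      H (x, t) / R (x, t) / t ^ (U.card * N) := by
    intro x t
    have h1 : ∏ p ∈ U, lin p (ins i k x t - ins i k P 0) = a * t ^ U.card := by
      rw [← Finset.prod_const, ← Finset.prod_mul_distrib]
      refine Finset.prod_congr rfl fun p hp => ?_
      rw [hlin p (x, t), (Finset.mem_filter.1 hp).2]
      simp [lin, mul_comm]
    rw [div_div, eqn, ← Finset.prod_filter_mul_prod_filter_not S fun p => mrg i k p.1 = mrg i k p.2]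
    change _ / ((∏ p ∈ U, _) * ∏ p ∈ T, _) ^ N = _
    rw [h1, pow_mul, ← mul_pow]
    congr 2
    ring
  have hR0 : ∀ x, R (x, 0) = (a * ∏ p ∈ T, lin (mrg i k p.1, mrg i k p.2) (x - P)) ^ N := by
    intro x
    simp only [R, hlin _ (x, (0 : ℂ)), zero_mul, add_zero]
  have hR0' : ∀ x ∈ conf L n, R (x, 0) ≠ 0 := by
    intro x hx
    rw [hR0]
    exact pow_ne_zero _ (mul_ne_zero ha0 (Finset.prod_ne_zero_iff.2 fun p hp =>
      (inv_lin_aux (hT p hp).1 (hT p hp).2).1 x hx))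
  have hins := analyticAt_ins i k (P, (0 : ℂ))
  have hH : AnalyticAt ℂ H (P, 0) :=
    AnalyticAt.fun_comp (f := fun z : (Fin n → ℂ) × ℂ => ins i k z.1 z.2) (x := (P, 0)) hh hins
  have hR : AnalyticAt ℂ R (P, 0) := by
    refine (analyticAt_const.mul (Finset.analyticAt_fun_prod _ fun p _ => ?_)).pow N
    exact AnalyticAt.fun_comp (f := fun z : (Fin n → ℂ) × ℂ => ins i k z.1 z.2) (x := (P, 0))
      (analyticAt_lin p _ _) hins
  have hct : ContinuousAt (fun x : Fin n → ℂ => (x, (0 : ℂ))) P := by fun_prop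
  have hslice : ∀ y : Fin n → ℂ, AnalyticAt ℂ (fun s : ℂ => (y, s)) 0 := fun y =>
    analyticAt_const.prod analyticAt_id
  have hquot : ∀ᶠ x in 𝓝 P, x ∈ conf L n → AnalyticAt ℂ (fun t => H (x, t) / R (x, t)) 0 := by
    filter_upwards [hct.eventually hH.eventually_analyticAt,
      hct.eventually hR.eventually_analyticAt] with x hx1 hx2 hx
    exact (hx1.fun_comp (hslice x)).div (hx2.fun_comp (hslice x)) (hR0' x hx)
  simp only [heq]
  refine ⟨?_, ?_⟩
  · filter_upwards [hquot] with x hx hxc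
    exact meromorphicAt_of_eq_div_pow (hx hxc) (Eventually.of_forall fun _ => rfl)
  by_cases hm : 0 ≤ m + (U.card * N : ℕ)
  · set M := (m + (U.card * N : ℕ)).toNat with hM
    obtain ⟨K, hK, hKe⟩ := iteratedDeriv_div hH hR M
    obtain ⟨S', hS', hcard, hpol⟩ := polarOn_prod_inv_lin i k hT
    have hcard' : (S'.card : ℤ) ≤ if 0 ≤ m then c else c - 1 := by
      split_ifs with hm0
      · omega
      -- a nonzero polar coefficient forces `{x_i = x_j} ∈ S`, so `T` is smaller than `S`
      · have : U.card ≠ 0 := by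
          intro h0
          rw [h0] at hm
          simp at hm
          exact hm0 hm
        omega
    have hK0 : AnalyticAt ℂ (fun x : Fin n → ℂ => K (x, 0) / (M.factorial : ℂ) *
        ((a⁻¹) ^ N) ^ (M + 1)) P :=
      ((AnalyticAt.fun_comp (f := fun x : Fin n → ℂ => (x, (0 : ℂ))) (x := P) hK
        (analyticAt_id.prod analyticAt_const)).div_const).mul analyticAt_const
    refine PolarOn.exists_mem_polarSpan (((PolarOn.of_analyticAt hK0).mul
      ((hpol.pow N).pow (M + 1))).congr ?_) hS' hcard'
    filter_upwards [hquot, hct.eventually hKe] with x hx1 hx2 hx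
    rw [laurentCoeff_eq (hx1 hx) (Eventually.of_forall fun _ => rfl), if_pos hm, ← hM,
      hx2 (hR0' x hx), hR0, Finset.prod_inv_distrib]
    simp only [mul_pow, inv_pow]
    field_simp
  · refine ⟨0, zero_mem _, ?_⟩
    filter_upwards [hquot] with x hx hxc
    rw [laurentCoeff_eq (hx hxc) (Eventually.of_forall fun _ => rfl), if_neg hm]
    rfl

lemma laurentCoeff_of_mem_polarSpan {L : PeriodPair} {n : ℕ} (i k : Fin (n + 1)) {P : Fin n → ℂ}
    {c : ℤ} {g : (Fin (n + 1) → ℂ) → ℂ} (hg : g ∈ polarSpan L (ins i k P 0) c) (m : ℤ) :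
    (∀ᶠ x in 𝓝 P, x ∈ conf L n → MeromorphicAt (fun t => g (ins i k x t)) 0) ∧
    ∃ g' ∈ polarSpan L P (if 0 ≤ m then c else c - 1), ∀ᶠ x in 𝓝 P, x ∈ conf L n →
      laurentCoeff (fun t => g (ins i k x t)) m = g' x := by
  induction hg using Submodule.span_induction with
  | mem g hg =>
    obtain ⟨S, hS, hc, h, N, hh, rfl⟩ := hg
    exact laurentCoeff_div_eqn i k hS hc hh N m
  | zero =>
    have h0 : AnalyticAt ℂ (fun _ : ℂ => (0 : ℂ)) 0 := analyticAt_const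
    refine ⟨Eventually.of_forall fun x _ => h0.meromorphicAt, 0, zero_mem _,
      Eventually.of_forall fun x _ => ?_⟩
    have := laurentCoeff_const_mul h0.meromorphicAt 0 m
    simpa using this
  | add g₁ g₂ _ _ h₁ h₂ =>
    obtain ⟨hm₁, g₁', hg₁, he₁⟩ := h₁
    obtain ⟨hm₂, g₂', hg₂, he₂⟩ := h₂
    refine ⟨?_, g₁' + g₂', add_mem hg₁ hg₂, ?_⟩
    · filter_upwards [hm₁, hm₂] with x h1 h2 hx
      exact (h1 hx).add (h2 hx)
    · filter_upwards [hm₁, hm₂, he₁, he₂] with x h1 h2 h3 h4 hx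
      rw [Pi.add_apply, ← h3 hx, ← h4 hx, ← laurentCoeff_add (h1 hx) (h2 hx)]
      rfl
  | smul r g _ h =>
    obtain ⟨hm, g', hg', he⟩ := h
    refine ⟨?_, r • g', Submodule.smul_mem _ r hg', ?_⟩
    · filter_upwards [hm] with x h1 hx
      exact (MeromorphicAt.const r 0).mul (h1 hx)
    · filter_upwards [hm, he] with x h1 h3 hx
      rw [Pi.smul_apply, smul_eq_mul, ← h3 hx, ← laurentCoeff_const_mul (h1 hx)]
      rfl

/-- The bound on the number of divisors is `q + n + 1` on `F(X, n + 1)` and `q + n` on `F(X, n)`, so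
keeping the number of divisors costs one step of the filtration and losing one costs nothing. -/
lemma coeff_mem_filGam {L : PeriodPair} {n : ℕ} (i k : Fin (n + 1)) {q : ℤ} {f : Gam L (n + 1)}
    (hf : f ∈ filGam L (n + 1) q) (m : ℤ) :
    coeff L i k m f ∈ filGam L n (if 0 ≤ m then q + 1 else q) := by
  intro P
  obtain ⟨g, hg, hfg⟩ := hf (ins i k P 0)
  obtain ⟨hmer, g', hg', he⟩ := laurentCoeff_of_mem_polarSpan i k (c := q + (n + 1 : ℕ)) hg m
  refine ⟨g', ?_, ?_⟩
  · have hc : (if 0 ≤ m then q + (n + 1 : ℕ) else q + (n + 1 : ℕ) - 1) =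
        (if 0 ≤ m then q + 1 else q) + n := by
      split_ifs <;> push_cast <;> ring
    rw [hc] at hg'
    exact hg'
  · have hc1 : ContinuousAt (fun z : (Fin n → ℂ) × ℂ => ins i k z.1 z.2) (P, 0) :=
      (analyticAt_ins i k (P, 0)).continuousAt
    have hc2 : ContinuousAt (fun x : Fin n → ℂ => (x, (0 : ℂ))) P := by fun_prop
    filter_upwards [hmer, he, hc2.eventually (hc1.eventually hfg).eventually_nhds]
      with x h1 h2 h3 hx
    rw [← h2 hx]
    change coeffFun L i k m f.1 x = _
    rw [coeffFun, if_pos hx]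
    refine laurentCoeff_congr (h1 hx) ?_ m
    have hc3 : ContinuousAt (fun s : ℂ => (x, s)) 0 := by fun_prop
    filter_upwards [eventually_ins_mem_conf i k hx,
      eventually_nhdsWithin_of_eventually_nhds (hc3.eventually h3)] with t ht1 ht2
    exact ht2 ht1

/-! ### Stability of the Hodge filtration -/

section Hodge

variable {V : Type*} [AddCommGroup V] [Module ℂ V]

lemma merge_mem_filTensor {A : VertexAlgebra V} (G : GoodFiltration A) {n : ℕ} (i k : Fin (n + 1))
    {p : ℤ} {w : ⨂[ℂ] _ : Fin (n + 2), V} (hw : w ∈ filTensor G (n + 1) p) (m : ℤ) :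
    merge A i k m w ∈ filTensor G n (if 0 ≤ m then p - 1 else p) := by
  suffices h : filTensor G (n + 1) p ≤
      (filTensor G n (if 0 ≤ m then p - 1 else p)).comap (merge A i k m) from h hw
  refine Submodule.span_le.2 ?_
  rintro _ ⟨q, v, hq, hv, rfl⟩
  change merge A i k m _ ∈ filTensor G n _
  rw [merge_tprod]
  set r : ℤ := q i.castSucc + q (i.castSucc.succAbove k) - if 0 ≤ m then 1 else 0 with hr
  refine Submodule.subset_span ⟨Function.update (fun l => q (i.castSucc.succAbove l)) k r, _,
    ?_, fun l => ?_, rfl⟩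
  · rw [Fin.sum_univ_succAbove _ i.castSucc, Fin.sum_univ_succAbove _ k] at hq
    rw [Fin.sum_univ_succAbove _ k]
    simp only [Function.update_self, Function.update_of_ne (Fin.succAbove_ne k _), hr]
    split_ifs <;> linarith
  · by_cases hl : l = k
    · subst hl
      simp only [Function.update_self, hr]
      split_ifs with hm
      · exact G.mul_mem_of_nonneg _ _ _ (hv _) _ (hv _) m hm
      · rw [sub_zero]
        exact G.mul_mem _ _ _ (hv _) _ (hv _) m
    · rw [Function.update_of_ne hl, Function.update_of_ne hl]
      exact hv _

lemma tmul_mem_filCt {L : PeriodPair} {A : VertexAlgebra V} (G : GoodFiltration A) {n : ℕ}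
    {p q r : ℤ} (hpq : p + q ≤ r) {f : Gam L n} (hf : f ∈ filGam L n p)
    {w : ⨂[ℂ] _ : Fin (n + 1), V} (hw : w ∈ filTensor G n q) : f ⊗ₜ[ℂ] w ∈ filCt L G n r :=
  Submodule.mem_iSup_of_mem p (Submodule.mem_iSup_of_mem q (Submodule.mem_iSup_of_mem hpq
    (Submodule.apply_mem_map₂ _ hf hw)))

/-- Regular coefficients gain a divisor, which the products `a_(m) b`, `m ≥ 0`, compensate; polar
coefficients do not gain one. -/
lemma filCt_le_comap_resMap (L : PeriodPair) {A : VertexAlgebra V} (G : GoodFiltration A) {n : ℕ}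
    (i k : Fin (n + 1)) (p : ℤ) :
    filCt L G (n + 1) p ≤ (filCt L G n p).comap (resMap L A i k) := by
  refine iSup_le fun p' => iSup_le fun p'' => iSup_le fun hp => Submodule.map₂_le.2 ?_
  intro f hf w hw
  change resMap L A i k (f ⊗ₜ w) ∈ filCt L G n p
  rw [resMap_tmul]
  refine finsum_induction (fun ω => ω ∈ filCt L G n p) (zero_mem _) (fun _ _ => add_mem) fun m => ?_
  refine tmul_mem_filCt G ?_ (coeff_mem_filGam i k hf m) (merge_mem_filTensor G i k hw m)
  split_ifs <;> linarith

lemma filCt_mono (L : PeriodPair) {A : VertexAlgebra V} (G : GoodFiltration A) (n : ℕ) :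
    Monotone (filCt L G n) := fun _ _ h =>
  iSup_mono fun _ => iSup_mono fun _ => iSup_mono' fun hp => ⟨hp.trans h, le_rfl⟩

end Hodge

end ChiralHodge

theorem mainTheorem9 (τ : UpperHalfPlane) {V : Type*} [AddCommGroup V] [Module ℂ V]
    (A : ChiralHodge.GradedVertexAlgebra V)
    (G : ChiralHodge.GoodFiltration A.toVertexAlgebra) :
    ∃ d : ∀ n : ℕ, ChiralHodge.Ch (ChiralHodge.periods τ) A.toVertexAlgebra (n + 1) →ₗ[ℂ]
        ChiralHodge.Ch (ChiralHodge.periods τ) A.toVertexAlgebra n,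
      (∀ (n : ℕ) (ω : ChiralHodge.Ct (ChiralHodge.periods τ) V (n + 1)),
        d n (Submodule.Quotient.mk ω) =
          Submodule.Quotient.mk
            (ChiralHodge.dt (ChiralHodge.periods τ) A.toVertexAlgebra n ω)) ∧
      (∀ n : ℕ, Monotone (ChiralHodge.filCh (ChiralHodge.periods τ) G n)) ∧
      (∀ (n : ℕ) (p : ℤ),
        (ChiralHodge.filCh (ChiralHodge.periods τ) G (n + 1) p).map (d n) ≤
          ChiralHodge.filCh (ChiralHodge.periods τ) G n p) := by
  refine ⟨fun n => Submodule.mapQ _ _ _ (ChiralHodge.rel_le_comap_dt _ _ n), fun n ω => rfl,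
    fun n p p' h => Submodule.map_mono (ChiralHodge.filCt_mono _ G n h), fun n p => ?_⟩
  rintro _ ⟨_, ⟨ω, hω, rfl⟩, rfl⟩
  exact ⟨_, ChiralHodge.dt_mem _ _ _ fun i k =>
    ChiralHodge.filCt_le_comap_resMap _ G i k p hω, rfl⟩
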